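/- **Theorem (Existence of holomorphic volume forms).** Let $M$ be a simply connected complex manifold of complex dimension $n$, with complex structure $J$, and let $g$ be a gradient Kähler Ricci soliton on $M$ with Ricci potential $f$; that is, $g$ is a (smooth) Kähler metric on $M$, with associated Kähler form $\Omega(v,w)=g(Jv,w)$, and $f:M\to\mathbb{R}$ is a smooth function such that $\operatorname{Ric}(g)=D^2f$, where $\operatorname{Ric}(g)$ is the Ricci tensor of $g$ and $D^2f=\nabla^2 f$ is the Hessian of $f$ with respect to the Levi-Civita connection of $g$. Let $d\mathrm{vol}_g$ be the volume form of $g$ for the orientation determined by $J$. Then there exists a holomorphic volume form $\Upsilon$ on $M$ (a nowhere vanishing holomorphic section of the canonical bundle $\Lambda^{n,0}T^*M$) such that $$ d\mathrm{vol}_g=\frac1{n!}\,\Omega^n=\left(\frac{\mathrm{i}^n}{2}\right)^{n} e^{-f}\;\Upsilon\wedge\overline{\Upsilon}, $$ and $\Upsilon$ is unique up to multiplication by a complex number of modulus $1$: if $\Upsilon$ has this property, then the holomorphic volume forms with this property are exactly the forms $c\,\Upsilon$ with $c\in\mathbb{C}$ constant and $|c|=1$. (The wedge product is normalized so that $\alpha\wedge\beta=\alpha\otimes\beta-\beta\otimes\alpha$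 for $1$-forms.) -/

import Mathlib

open scoped Manifold ContDiff

set_option maxSynthPendingDepth 3

noncomputable section

/-- The model space `ℂⁿ`; it carries its complex structure and the underlying real one. -/
abbrev Cn (n : ℕ) : Type := EuclideanSpace ℂ (Fin n)

/-! ### Multilinear algebra: the wedge product

The normalization is `α ∧ β = α ⊗ β - β ⊗ α` for `1`-forms. -/

section Wedge

variable {V : Type*} [AddCommGroup V] [Module ℝ V]
  {A : Type*} [CommRing A] [Algebra ℝ A]

/-- The wedge product of alternating forms with values in a commutative `ℝ`-algebra
(a sum over shuffles). -/
def wedge {k l : ℕ} (a : V [⋀^Fin k]→ₗ[ℝ] A) (b : V [⋀^Fin l]→ₗ[ℝ] A) :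
    V [⋀^Fin (k + l)]→ₗ[ℝ] A :=
  ((LinearMap.mul' ℝ A).compAlternatingMap (a.domCoprod b)).domDomCongr finSumFinEquiv

/-- The `k`-th exterior power `η ∧ ⋯ ∧ η` of a `2`-form `η`, a form of degree `2k`. -/
def wedgePow (η : V [⋀^Fin 2]→ₗ[ℝ] A) : (k : ℕ) → V [⋀^Fin (2 * k)]→ₗ[ℝ] A
  | 0 => (AlternatingMap.constOfIsEmpty ℝ V (Fin 0) 1 : V [⋀^Fin 0]→ₗ[ℝ] A)
  | k + 1 => wedge (wedgePow η k) η

/-- A real form regarded as a complex valued form. -/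
def complexify {k : ℕ} (a : V [⋀^Fin k]→ₗ[ℝ] ℝ) : V [⋀^Fin k]→ₗ[ℝ] ℂ :=
  Complex.ofRealCLM.toLinearMap.compAlternatingMap a

/-- The complex conjugate of a complex valued form. -/
def conjForm {k : ℕ} (a : V [⋀^Fin k]→ₗ[ℝ] ℂ) : V [⋀^Fin k]→ₗ[ℝ] ℂ :=
  Complex.conjLIE.toLinearEquiv.toLinearMap.compAlternatingMap a

end Wedge

/-! ### Curvature and Hessian of a metric on a domain of a real vector space

In this section `G y` is the value at `y` of a Riemannian metric on an open subset of a
finite-dimensional real vector space `E`. -/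

section Local

variable {E : Type*} [NormedAddCommGroup E] [NormedSpace ℝ E]

/-- The Christoffel symbols of the first kind:
`(u, v, w) ↦ (1/2) (∂_u G(v, w) + ∂_v G(u, w) - ∂_w G(u, v))` for constant `u`, `v`, `w`. -/
def christoffelFirst (G : E → E →L[ℝ] E →L[ℝ] ℝ) (y : E) : E →L[ℝ] E →L[ℝ] E →L[ℝ] ℝ :=
  let D : E →L[ℝ] E →L[ℝ] E →L[ℝ] ℝ := fderiv ℝ G y
  (2⁻¹ : ℝ) • (D + D.flip -
    (ContinuousLinearMap.flipₗᵢ ℝ E E ℝ : (E →L[ℝ] E →L[ℝ] ℝ) →L[ℝ] E →L[ℝ] E →L[ℝ] ℝ) ∘L D.flip)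

theorem christoffelFirst_apply (G : E → E →L[ℝ] E →L[ℝ] ℝ) (y u v w : E) :
    christoffelFirst G y u v w =
      2⁻¹ * (fderiv ℝ G y u v w + fderiv ℝ G y v u w - fderiv ℝ G y w u v) := rfl

/-- The Christoffel symbols of the Levi-Civita connection, `∇_u v = Γ(u, v)` for constant vector
fields `u`, `v`: the vector `Γ(u, v)` is determined by
`G(Γ(u, v), w) = (1/2) (∂_u G(v, w) + ∂_v G(u, w) - ∂_w G(u, v))`. -/
def christoffel (G : E → E →L[ℝ] E →L[ℝ] ℝ) (y : E) : E →L[ℝ] E →L[ℝ] E :=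
  ContinuousLinearMap.compL ℝ E (E →L[ℝ] ℝ) E (G y).inverse ∘L christoffelFirst G y

/-- The curvature `u ↦ R(u, v) w`, where
`R(u, v) w = ∂_u (Γ(v, w)) - ∂_v (Γ(u, w)) + Γ(u, Γ(v, w)) - Γ(v, Γ(u, w))`. -/
def curvature (G : E → E →L[ℝ] E →L[ℝ] ℝ) (y v w : E) : E →L[ℝ] E :=
  ((fderiv ℝ (christoffel G) y).flip v).flip w
    - (fderiv ℝ (christoffel G) y v).flip w
    + (christoffel G y).flip (christoffel G y v w)
    - christoffel G y v ∘L (christoffel G y).flip w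

theorem curvature_apply (G : E → E →L[ℝ] E →L[ℝ] ℝ) (y u v w : E) :
    curvature G y v w u =
      fderiv ℝ (christoffel G) y u v w - fderiv ℝ (christoffel G) y v u w
        + christoffel G y u (christoffel G y v w)
        - christoffel G y v (christoffel G y u w) := rfl

/-- The Ricci tensor `Ric(v, w) = tr (u ↦ R(u, v) w)`. -/
def ricci (G : E → E →L[ℝ] E →L[ℝ] ℝ) (y v w : E) : ℝ :=
  LinearMap.trace ℝ E (curvature G y v w).toLinearMap

/-- The Hessian `(D²h)(v, w) = ∂_v ∂_w h - dh(Γ(v, w))`. -/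
def hessian (G : E → E →L[ℝ] E →L[ℝ] ℝ) (h : E → ℝ) (y v w : E) : ℝ :=
  fderiv ℝ (fderiv ℝ h) y v w - fderiv ℝ h y (christoffel G y v w)

end Local

/-! ### Complex manifolds -/

section Manifold

variable {n : ℕ} {M : Type*} [TopologicalSpace M] [ChartedSpace (Cn n) M]

/-- A complex manifold is a real manifold. -/
instance isManifold_real_of_complex [IsManifold 𝓘(ℂ, Cn n) ω M] :
    IsManifold 𝓘(ℝ, Cn n) ω M := by
  refine isManifold_of_contDiffOn _ _ _ fun e e' he he' => ?_
  have h := (contDiffGroupoid ω 𝓘(ℂ, Cn n)).compatible he he'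
  rw [contDiffGroupoid, mem_groupoid_of_pregroupoid] at h
  exact h.1.restrict_scalars ℝ

variable (M) in
/-- Multiplication by `i` on the tangent space at `x`. -/
def complexStructure (x : M) : TangentSpace 𝓘(ℝ, Cn n) x →L[ℝ] TangentSpace 𝓘(ℝ, Cn n) x :=
  (Complex.I • ContinuousLinearMap.id ℝ (Cn n) : Cn n →L[ℝ] Cn n)

/-- The real differential at `y` of the inverse of the chart `φ`. -/
def dChartSymm (φ : OpenPartialHomeomorph M (Cn n)) (y : Cn n) :
    Cn n →L[ℝ] TangentSpace 𝓘(ℝ, Cn n) (φ.symm y) :=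
  mfderiv 𝓘(ℝ, Cn n) 𝓘(ℝ, Cn n) φ.symm y

/-- The complex differential at `y` of the inverse of the chart `φ`. -/
def dChartSymmC (φ : OpenPartialHomeomorph M (Cn n)) (y : Cn n) :
    Cn n →L[ℂ] TangentSpace 𝓘(ℂ, Cn n) (φ.symm y) :=
  mfderiv 𝓘(ℂ, Cn n) 𝓘(ℂ, Cn n) φ.symm y

variable [IsManifold 𝓘(ℂ, Cn n) ω M]

variable (n M) in
/-- A smooth Hermitian metric, i.e. a smooth Riemannian metric `g` on the underlying real manifold
that is compatible with the complex structure `J`. -/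
structure HermitianMetric extends Bundle.ContMDiffRiemannianMetric 𝓘(ℝ, Cn n) ∞ (Cn n)
    (fun x : M => TangentSpace 𝓘(ℝ, Cn n) x) where
  inner_J : ∀ (x : M) (v w : TangentSpace 𝓘(ℝ, Cn n) x),
    inner x (complexStructure M x v) (complexStructure M x w) = inner x v w

namespace HermitianMetric

variable (g : HermitianMetric n M)

/-- The associated `2`-form `Ω(v, w) = g(J v, w)`. -/
def kahlerForm (x : M) : TangentSpace 𝓘(ℝ, Cn n) x [⋀^Fin 2]→L[ℝ] ℝ where
  toFun v := g.inner x (complexStructure M x (v 0)) (v 1)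
  map_update_add' v i a b := by
    fin_cases i <;> simp [Function.update]
  map_update_smul' v i c a := by
    fin_cases i <;> simp [Function.update]
  cont := by
    let B : Cn n →L[ℝ] Cn n →L[ℝ] ℝ := g.inner x
    let J : Cn n →L[ℝ] Cn n := complexStructure M x
    have h : Continuous fun v : Fin 2 → Cn n => B (J (v 0)) (v 1) := by fun_prop
    exact h
  map_eq_zero_of_eq' v i j hv hij := by
    have h01 : v 0 = v 1 := by
      fin_cases i <;> fin_cases j <;> simp_all
    have hJ : complexStructure M x (complexStructure M x (v 1)) = -(v 1) := by
      have hI (w : Cn n) : Complex.I • (Complex.I • w) = -w := by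
        rw [smul_smul, Complex.I_mul_I, neg_one_smul]
      exact hI (v 1)
    have h := g.inner_J x (complexStructure M x (v 1)) (v 1)
    rw [hJ, map_neg, neg_apply, g.symm x (v 1)] at h
    rw [h01]
    linarith

/-- The metric read in the chart `φ`, i.e. the pullback of `g` under the inverse of `φ`. -/
def inChart (φ : OpenPartialHomeomorph M (Cn n)) (y : Cn n) : Cn n →L[ℝ] Cn n →L[ℝ] ℝ :=
  let B : Cn n →L[ℝ] Cn n →L[ℝ] ℝ := g.inner (φ.symm y)
  let L : Cn n →L[ℝ] Cn n := dChartSymm φ y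
  B.bilinearComp L L

/-- The associated `2`-form read in the chart `φ`. -/
def kahlerFormInChart (φ : OpenPartialHomeomorph M (Cn n)) (y : Cn n) : Cn n [⋀^Fin 2]→L[ℝ] ℝ :=
  (g.kahlerForm (φ.symm y)).compContinuousLinearMap (dChartSymm φ y)

/-- The metric is Kähler: its associated `2`-form is closed. -/
def IsKahler : Prop :=
  ∀ φ ∈ atlas (Cn n) M, ∀ y ∈ φ.target, extDeriv (g.kahlerFormInChart φ) y = 0

/-- `g` is a gradient Kähler Ricci soliton with Ricci potential `f`: it is a Kähler metric, `f` is
a smooth real function, and `Ric(g) = D²f` (as tensors, hence in every chart of the atlas). -/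
structure IsGradientRicciSoliton (f : M → ℝ) : Prop where
  isKahler : g.IsKahler
  contMDiff_potential : ContMDiff 𝓘(ℝ, Cn n) 𝓘(ℝ, ℝ) ∞ f
  ricci_eq_hessian : ∀ φ ∈ atlas (Cn n) M, ∀ y ∈ φ.target, ∀ v w : Cn n,
    ricci (g.inChart φ) y v w = hessian (g.inChart φ) (f ∘ φ.symm) y v w

/-- The real basis `e₁, i e₁, …, eₙ, i eₙ` of the tangent space at `x`; it is positively oriented
for the orientation determined by the complex structure. -/
def tangentBasis (x : M) : Module.Basis (Fin (2 * n)) ℝ (TangentSpace 𝓘(ℝ, Cn n) x) :=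
  (Module.Basis.smulTower' Complex.basisOneI (EuclideanSpace.basisFun (Fin n) ℂ).toBasis :
    Module.Basis (Fin n × Fin 2) ℝ (Cn n)).reindex
      (finProdFinEquiv.trans (finCongr (Nat.mul_comm n 2)))

/-- The Riemannian volume form of `g` for the orientation determined by the complex structure:
`√(det (g(b_i, b_j))) b¹ ∧ ⋯ ∧ b²ⁿ` for a positively oriented real basis `b` with dual
basis `b¹, …, b²ⁿ`. -/
def volumeForm (x : M) : TangentSpace 𝓘(ℝ, Cn n) x [⋀^Fin (2 * n)]→ₗ[ℝ] ℝ :=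
  √(Matrix.det (Matrix.of fun i j => g.inner x (tangentBasis x i) (tangentBasis x j))) •
    (tangentBasis x).det

end HermitianMetric

variable (n M) in
/-- Forms of type `(n, 0)`: sections of the canonical bundle, i.e. at each point a complex
multilinear alternating `n`-form on the holomorphic tangent space. -/
abbrev CanonicalSection : Type _ := (x : M) → TangentSpace 𝓘(ℂ, Cn n) x [⋀^Fin n]→L[ℂ] ℂ

/-- A holomorphic volume form: a nowhere vanishing form of type `(n, 0)` that is holomorphic,
i.e. its coefficient in each holomorphic chart is holomorphic. -/
structure IsHolomorphicVolumeForm (Υ : CanonicalSection n M) : Prop where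
  ne_zero : ∀ x, Υ x ≠ 0
  holomorphic : ∀ φ ∈ atlas (Cn n) M, DifferentiableOn ℂ
    (fun y : Cn n => ((Υ (φ.symm y)).compContinuousLinearMap (dChartSymmC φ y) :
      Cn n [⋀^Fin n]→L[ℂ] ℂ)) φ.target

/-- A form of type `(n, 0)` as a complex valued form on the real tangent space. -/
def CanonicalSection.toReal (Υ : CanonicalSection n M) (x : M) :
    TangentSpace 𝓘(ℝ, Cn n) x [⋀^Fin n]→ₗ[ℝ] ℂ :=
  ((Υ x : Cn n [⋀^Fin n]→L[ℂ] ℂ).restrictScalars ℝ : Cn n [⋀^Fin n]→L[ℝ] ℂ).toAlternatingMap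

/-- The form `Υ ∧ Ῡ`, of degree `2n`. -/
def CanonicalSection.wedgeConj (Υ : CanonicalSection n M) (x : M) :
    TangentSpace 𝓘(ℝ, Cn n) x [⋀^Fin (2 * n)]→ₗ[ℝ] ℂ :=
  (wedge (Υ.toReal x) (conjForm (Υ.toReal x))).domDomCongr (finCongr (two_mul n).symm)

/-- `Υ` is a holomorphic volume form with `dvol_g = (iⁿ/2)ⁿ e^{-f} Υ ∧ Ῡ`. -/
structure IsAssociatedVolumeForm (g : HermitianMetric n M) (f : M → ℝ)
    (Υ : CanonicalSection n M) : Prop where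
  isHolomorphicVolumeForm : IsHolomorphicVolumeForm Υ
  volumeForm_eq : ∀ x : M, complexify (g.volumeForm x) =
    ((Complex.I ^ n / 2) ^ n * (Real.exp (-f x) : ℂ)) • Υ.wedgeConj x

end Manifold

end

/-! In a holomorphic chart let `G` be the matrix of the Kähler metric. Being Kähler makes the
Christoffel symbols complex bilinear, and the trace of `Γ(w, ·)` is `∂_w log √(det G)`. Hence the
part of the Ricci tensor invariant under multiplication by `i` is minus the invariant part of the
second derivative of `log √(det G)` (`ricci_add_ricci_I`). In the invariant part of the Hessian of
`f` the connection term cancels, so the soliton equation says that `log √(det G) + f` is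
pluriharmonic (`pluriharmonic_of_ricci_eq_hessian`).

On a ball such a function is `Re h` with `h` holomorphic, and `a = exp (h / 2)` satisfies `√(det G)
= e^{-f} |a|²`. By the pointwise algebra of `complexify_smul_det_eq_iff` this says that `a dz₁ ∧ ⋯ ∧
dzₙ` has the required property, which gives local existence (`exists_isAssociatedOn`).

The ratio of two local solutions is holomorphic of modulus `1`, hence locally constant by the
maximum principle (`eventually_div_eq`). On a connected manifold this is uniqueness up to a unit
constant. For existence, the ratios form a locally constant cocycle with values in the circle; it
defines a covering space, which has a global section since `M` is simply connected
(`exists_locally_constant_primitive_of_cocycle`), and the section corrects the local solutions so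
that they agree on overlaps.

The identity between the volume form and `Ωⁿ / n!` is linear algebra in a unitary frame
(`sqrt_gramDet_smul_det`). -/

noncomputable section

/-! ### Wedge products of linear forms -/

section WedgeOfLinearForms

variable {V : Type*} [AddCommGroup V] [Module ℝ V]
  {A : Type*} [CommRing A] [Algebra ℝ A]
  {ι : Type*} [Fintype ι] [DecidableEq ι]

/-- The wedge product of a family of linear forms. -/
def detForm (a : ι → V →ₗ[ℝ] A) : V [⋀^ι]→ₗ[ℝ] A :=
  MultilinearMap.alternatization ((MultilinearMap.mkPiAlgebra ℝ ι A).compLinearMap a)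

theorem detForm_apply (a : ι → V →ₗ[ℝ] A) (v : ι → V) :
    detForm a v = Matrix.det (Matrix.of fun i j => a i (v j)) := by
  rw [detForm, MultilinearMap.alternatization_apply, ← Matrix.det_transpose, Matrix.det_apply]
  rfl

/-- The shuffle product of two alternatizations is the alternatization of the tensor product. No
factorials occur, which is the chosen normalization of the wedge. -/
theorem wedge_detForm {k l : ℕ} (a : Fin k → V →ₗ[ℝ] A) (b : Fin l → V →ₗ[ℝ] A) :
    wedge (detForm a) (detForm b) = detForm (Fin.append a b) := by
  ext v
  rw [wedge, detForm, detForm, ← MultilinearMap.domCoprod_alternization,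
    AlternatingMap.domDomCongr_apply, LinearMap.compAlternatingMap_apply,
    MultilinearMap.alternatization_apply, detForm, MultilinearMap.alternatization_apply, map_sum]
  refine Fintype.sum_equiv finSumFinEquiv.permCongr _ _ fun σ => ?_
  rw [Equiv.Perm.sign_permCongr]
  simp [Units.smul_def, Fin.prod_univ_add, -zsmul_eq_mul]

omit [Fintype ι] [DecidableEq ι] in
theorem wedge_sum_sum {κ : Type*} (s : Finset ι) (t : Finset κ) {k l : ℕ}
    (a : ι → V [⋀^Fin k]→ₗ[ℝ] A) (b : κ → V [⋀^Fin l]→ₗ[ℝ] A) :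
    wedge (∑ i ∈ s, a i) (∑ j ∈ t, b j) = ∑ i ∈ s, ∑ j ∈ t, wedge (a i) (b j) := by
  have h (a : V [⋀^Fin k]→ₗ[ℝ] A) (b : V [⋀^Fin l]→ₗ[ℝ] A) : wedge a b =
      AlternatingMap.domDomCongrₗ ℝ finSumFinEquiv 
        (LinearMap.compAlternatingMapₗ ℝ (LinearMap.mul' ℝ A)
        (AlternatingMap.domCoprod' (TensorProduct.tmul ℝ a b))) := rfl
  simp only [h, TensorProduct.sum_tmul, TensorProduct.tmul_sum, map_sum]
  exact Finset.sum_comm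

/-- The tensor product behind `wedge` is over `ℝ`, so scalars from `A` have to be pulled out of each
shuffle term separately. -/
theorem wedge_smul_smul {k l : ℕ} (c d : A)
    (a : V [⋀^Fin k]→ₗ[ℝ] A) (b : V [⋀^Fin l]→ₗ[ℝ] A) :
    wedge (c • a) (d • b) = (c * d) • wedge a b := by
  ext v
  simp only [wedge, AlternatingMap.domDomCongr_apply, AlternatingMap.smul_apply,
    LinearMap.compAlternatingMap_apply, AlternatingMap.domCoprod_apply, sum_apply, map_sum,
    smul_eq_mul, Finset.mul_sum]
  refine Finset.sum_congr rfl fun σ _ => ?_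
  induction σ using Quotient.inductionOn' with | _ σ
  have h (a : V [⋀^Fin k]→ₗ[ℝ] A) (b : V [⋀^Fin l]→ₗ[ℝ] A) :
      LinearMap.mul' ℝ A (AlternatingMap.domCoprod.summand a b (Quotient.mk'' σ)
        (v ∘ finSumFinEquiv)) = (Equiv.Perm.sign σ : ℤ) •
      ((a fun i => v (finSumFinEquiv (σ (Sum.inl i)))) *
        b fun i => v (finSumFinEquiv (σ (Sum.inr i)))) := by
    rw [← LinearMap.mul'_apply (R := ℝ), ← map_zsmul]
    rfl
  rw [h, h, mul_smul_comm, AlternatingMap.smul_apply, AlternatingMap.smul_apply, smul_eq_mul,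
    smul_eq_mul]
  congr 1
  ring

/-- The order `(0, 0), (0, 1), (1, 0), (1, 1), …` on pairs. -/
def pairEquiv (n : ℕ) : Fin (2 * n) ≃ Fin n × Fin 2 :=
  ((finProdFinEquiv (m := n) (n := 2)).trans (finCongr (Nat.mul_comm n 2))).symm

theorem pairEquiv_fst_val {n : ℕ} (i : Fin (2 * n)) : ((pairEquiv n i).1 : ℕ) = i / 2 := rfl

theorem pairEquiv_snd_val {n : ℕ} (i : Fin (2 * n)) : ((pairEquiv n i).2 : ℕ) = i % 2 := rfl

/-- Multinomial expansion: each new factor contributes a last index, whence `Fin.snoc`. -/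
theorem wedgePow_sum_detForm {n : ℕ} (c : Fin n → Fin 2 → V →ₗ[ℝ] A) (m : ℕ) :
    wedgePow (∑ k, detForm (c k)) m =
      ∑ s : Fin m → Fin n, detForm fun i => c (s (pairEquiv m i).1) (pairEquiv m i).2 := by
  induction m with
  | zero =>
    ext v
    simp [wedgePow, detForm_apply]
  | succ m ih =>
    rw [wedgePow, ih, wedge_sum_sum, ← (Fin.snocEquiv fun _ => Fin n).sum_comp,
      Fintype.sum_prod_type_right]
    refine Finset.sum_congr rfl fun s _ => Finset.sum_congr rfl fun k _ => ?_
    rw [wedge_detForm]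
    congr 1
    funext i
    refine Fin.addCases (fun i => ?_) (fun i => ?_) i
    · have h1 : (pairEquiv (m + 1) (Fin.castAdd 2 i)).1 = Fin.castSucc (pairEquiv m i).1 := by
        ext; simp [pairEquiv_fst_val]
      have h2 : (pairEquiv (m + 1) (Fin.castAdd 2 i)).2 = (pairEquiv m i).2 := by
        ext; simp [pairEquiv_snd_val]
      rw [Fin.append_left]
      change _ = c (Fin.snoc (α := fun _ => Fin n) s k (pairEquiv (m + 1) (Fin.castAdd 2 i)).1)
        (pairEquiv (m + 1) (Fin.castAdd 2 i)).2
      rw [h1, h2, Fin.snoc_castSucc]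
    · have h1 : (pairEquiv (m + 1) (Fin.natAdd (2 * m) i)).1 = Fin.last m := by
        ext; simp [pairEquiv_fst_val]; omega
      have h2 : (pairEquiv (m + 1) (Fin.natAdd (2 * m) i)).2 = i := by
        ext; simp [pairEquiv_snd_val]; omega
      rw [Fin.append_right]
      change _ = c (Fin.snoc (α := fun _ => Fin n) s k (pairEquiv (m + 1) (Fin.natAdd (2 * m) i)).1)
        (pairEquiv (m + 1) (Fin.natAdd (2 * m) i)).2
      rw [h1, h2, Fin.snoc_last]

theorem detForm_comp_perm (a : ι → V →ₗ[ℝ] A) (σ : Equiv.Perm ι) :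
    detForm (fun i => a (σ i)) = ((Equiv.Perm.sign σ : ℤ) : A) • detForm a := by
  ext v
  rw [AlternatingMap.smul_apply, detForm_apply, detForm_apply]
  exact Matrix.det_permute σ (Matrix.of fun i j => a i (v j))

/-- Two-forms commute: `s` acts once on the first members and once on the second members of the
pairs, so its sign enters squared. -/
theorem detForm_pair_comp_perm {n : ℕ} (c : Fin n → Fin 2 → V →ₗ[ℝ] A) (s : Equiv.Perm (Fin n)) :
    detForm (fun i => c (s (pairEquiv n i).1) (pairEquiv n i).2) =
      detForm fun i : Fin (2 * n) => c (pairEquiv n i).1 (pairEquiv n i).2 := by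
  let σ : Equiv.Perm (Fin n × Fin 2) := Equiv.prodCongrLeft fun _ => s
  have h := detForm_comp_perm (fun i => c (pairEquiv n i).1 (pairEquiv n i).2)
    ((pairEquiv n).symm.permCongr σ)
  rw [Equiv.Perm.sign_permCongr, Equiv.Perm.sign_prodCongrLeft] at h
  simpa [σ, Equiv.permCongr_apply, Int.units_mul_self] using h

/-- A repeated index gives two equal rows, so only permutations survive in the expansion; their `n!`
terms are equal. -/
theorem wedgePow_sum_detForm_self {n : ℕ} (c : Fin n → Fin 2 → V →ₗ[ℝ] A) :
    wedgePow (∑ k, detForm (c k)) n =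
      (n.factorial : ℝ) • detForm fun i => c (pairEquiv n i).1 (pairEquiv n i).2 := by
  classical
  rw [wedgePow_sum_detForm]
  have h0 (s : Fin n → Fin n) (hs : ¬ Function.Injective s) :
      detForm (fun i => c (s (pairEquiv n i).1) (pairEquiv n i).2) = 0 := by
    simp only [Function.Injective, not_forall] at hs
    obtain ⟨k, l, hkl, hne⟩ := hs
    ext v
    rw [detForm_apply]
    refine Matrix.det_zero_of_row_eq (i := (pairEquiv n).symm (k, 0))
      (j := (pairEquiv n).symm (l, 0)) (by simpa using hne) ?_
    ext j
    simp [hkl]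
  rw [← Finset.sum_subset (Finset.subset_univ
    (Finset.univ.image fun σ : Equiv.Perm (Fin n) => (σ : Fin n → Fin n)))]
  · rw [Finset.sum_image (by exact fun _ _ _ _ h => DFunLike.coe_injective h)]
    simp only [detForm_pair_comp_perm]
    rw [Finset.sum_const, Finset.card_univ, Fintype.card_perm, Fintype.card_fin,
      Nat.cast_smul_eq_nsmul]
  · intro s _ hs
    refine h0 s fun hinj => hs ?_
    simp only [Finset.mem_image, Finset.mem_univ, true_and]
    exact ⟨Equiv.ofBijective s (Finite.injective_iff_bijective.mp hinj), rfl⟩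

end WedgeOfLinearForms

/-! ### The form `dz₁ ∧ ⋯ ∧ dzₙ ∧ dz̄₁ ∧ ⋯ ∧ dz̄ₙ` -/

/-- The permutation `2k + ε ↦ k + nε` of `{0, …, 2n - 1}`. -/
def unriffle (n : ℕ) : Equiv.Perm (Fin (2 * n)) :=
  (pairEquiv n).trans ((Equiv.prodComm _ _).trans finProdFinEquiv)

theorem unriffle_val {n : ℕ} (i : Fin (2 * n)) : (unriffle n i : ℕ) = i / 2 + n * (i % 2) := rfl

/-- Inversions are the pairs `i < j` with `i` odd and `j` even. Below `j = 2l` there are `l` odd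
numbers; an odd `j` contributes nothing. -/
theorem sign_unriffle (n : ℕ) :
    Equiv.Perm.sign (unriffle n) = ∏ l ∈ Finset.range n, (-1 : ℤˣ) ^ l := by
  have hlt (i j : Fin (2 * n)) (hij : i < j) :
      unriffle n i < unriffle n j ↔ ¬ ((i : ℕ) % 2 = 1 ∧ (j : ℕ) % 2 = 0) := by
    have h1 : (i : ℕ) < j := hij
    have h2 := i.2
    have h3 := j.2
    rw [Fin.lt_def, unriffle_val, unriffle_val]
    rcases Nat.mod_two_eq_zero_or_one i with h | h <;>
      rcases Nat.mod_two_eq_zero_or_one j with h' | h' <;> simp [h, h'] <;> omega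
  let g (i j : ℕ) : ℤˣ := if i % 2 = 1 ∧ j % 2 = 0 then -1 else 1
  have h1 : Equiv.Perm.sign (unriffle n) =
      ∏ j ∈ Finset.range (2 * n), ∏ i ∈ Finset.range j, g i j := by
    rw [Equiv.Perm.sign_eq_prod_prod_Iio,
      ← Fin.prod_univ_eq_prod_range (fun j => ∏ i ∈ Finset.range j, g i j)]
    refine Finset.prod_congr rfl fun j _ => ?_
    refine Finset.prod_bij (fun i _ => (i : ℕ)) ?_ ?_ ?_ ?_
    · intro i hi
      simpa using hi
    · intro i _ i' _ h
      exact Fin.ext h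
    · intro i hi
      have hi' : i < j := by simpa using hi
      exact ⟨⟨i, hi'.trans j.2⟩, by simpa [Fin.lt_def] using hi', rfl⟩
    · intro i hi
      have hi' : i < j := by simpa using hi
      simp only [hlt i j hi', g, ite_not]
  have heven (l : ℕ) : ∏ i ∈ Finset.range (2 * l), g i (2 * l) = (-1) ^ l := by
    have : ∀ m, ∏ i ∈ Finset.range (2 * m), g i (2 * l) = (-1) ^ m := fun m => by
      induction m with
      | zero => simp
      | succ m ih =>
        rw [Nat.mul_succ, Finset.prod_range_succ, Finset.prod_range_succ, ih, pow_succ]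
        simp [g, Nat.add_mod]
    exact this l
  have hodd (l : ℕ) : ∏ i ∈ Finset.range (2 * l + 1), g i (2 * l + 1) = 1 :=
    Finset.prod_eq_one fun i _ => by simp [g, Nat.add_mod]
  rw [h1]
  clear h1 hlt
  induction n with
  | zero => simp
  | succ n ih =>
    rw [Nat.mul_succ, Finset.prod_range_succ, Finset.prod_range_succ, ih,
      Finset.prod_range_succ _ n, heven, hodd, mul_one]

/-- The second factor is the value of `dz₁ ∧ ⋯ ∧ dzₙ ∧ dz̄₁ ∧ ⋯ ∧ dz̄ₙ` on `e₁, i e₁, …, eₙ, i eₙ`;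
this is why the constant in the theorem is `(iⁿ/2)ⁿ`. -/
theorem I_pow_mul_prod (n : ℕ) :
    (Complex.I ^ n / 2) ^ n * ((-2 * Complex.I) ^ n * ∏ l ∈ Finset.range n, (-1 : ℂ) ^ l) = 1 := by
  have h : ∀ m : ℕ, Complex.I ^ (m * m) * ((-Complex.I) ^ m *
      ∏ l ∈ Finset.range m, (-1 : ℂ) ^ l) = 1 := fun m => by
    induction m with
    | zero => simp
    | succ m ih =>
      have h1 : Complex.I ^ ((m + 1) * (m + 1)) =
          Complex.I ^ (m * m) * (-1) ^ m * Complex.I := by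
        rw [show (m + 1) * (m + 1) = m * m + 2 * m + 1 by ring, pow_add, pow_add,
          pow_mul Complex.I 2 m, pow_one, Complex.I_sq]
      have h2 : ((-1 : ℂ) ^ m) * (-1) ^ m = 1 := by rw [← mul_pow]; simp
      rw [h1, Finset.prod_range_succ, pow_succ (-Complex.I)]
      linear_combination ih * ((-1) ^ m * (-1) ^ m) * (-Complex.I * Complex.I)
        + h2 * (-Complex.I * Complex.I) - Complex.I_sq
  have h2 : (2 : ℂ) ^ n ≠ 0 := pow_ne_zero _ two_ne_zero
  rw [div_pow, ← pow_mul, neg_mul_comm, mul_pow 2 (-Complex.I), div_mul_eq_mul_div,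
    div_eq_one_iff_eq h2]
  linear_combination 2 ^ n * h n

/-- The `k`-th complex coordinate. -/
def coord (n : ℕ) (k : Fin n) : Cn n →ₗ[ℝ] ℂ :=
  ((EuclideanSpace.proj k : Cn n →L[ℂ] ℂ).restrictScalars ℝ).toLinearMap

/-- The complex conjugate of the `k`-th complex coordinate. -/
def coordConj (n : ℕ) (k : Fin n) : Cn n →ₗ[ℝ] ℂ :=
  Complex.conjLIE.toLinearEquiv.toLinearMap ∘ₗ coord n k

/-- The real basis `e₁, i e₁, …, eₙ, i eₙ` of `ℂⁿ`. -/
def stdRealBasis (n : ℕ) : Module.Basis (Fin (2 * n)) ℝ (Cn n) :=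
  (Module.Basis.smulTower' Complex.basisOneI (EuclideanSpace.basisFun (Fin n) ℂ).toBasis :
    Module.Basis (Fin n × Fin 2) ℝ (Cn n)).reindex
      (finProdFinEquiv.trans (finCongr (Nat.mul_comm n 2)))

theorem stdRealBasis_apply {n : ℕ} (i : Fin (2 * n)) :
    stdRealBasis n i = (![1, Complex.I] (pairEquiv n i).2) •
      EuclideanSpace.single (pairEquiv n i).1 (1 : ℂ) := by
  rw [stdRealBasis, Module.Basis.reindex_apply, Module.Basis.smulTower'_apply]
  simp only [Complex.coe_basisOneI, OrthonormalBasis.coe_toBasis, EuclideanSpace.basisFun_apply]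
  rfl

/-- Reordering the basis as `e₁, …, eₙ, i e₁, …, i eₙ` costs the sign of `unriffle` and leaves a
block matrix with rows `(1, i)` and `(1, -i)`, of determinant `(-2i)ⁿ`. -/
theorem detForm_coord_coordConj_apply (n : ℕ) :
    ((detForm (Fin.append (coord n) (coordConj n))).domDomCongr (finCongr (two_mul n).symm))
      (stdRealBasis n) = (-2 * Complex.I) ^ n * ∏ l ∈ Finset.range n, (-1 : ℂ) ^ l := by
  let w (m : Fin (2 * n)) : Cn n :=
    (![1, Complex.I] (finProdFinEquiv.symm m).1) •
      EuclideanSpace.single (finProdFinEquiv.symm m).2 (1 : ℂ)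
  have hw : (stdRealBasis n : Fin (2 * n) → Cn n) = w ∘ unriffle n := by
    funext i
    rw [stdRealBasis_apply, Function.comp_apply]
    simp only [w, unriffle, Equiv.trans_apply, Equiv.symm_apply_apply, Equiv.prodComm_apply,
      Prod.fst_swap, Prod.snd_swap]
  rw [hw, AlternatingMap.map_perm, sign_unriffle, AlternatingMap.domDomCongr_apply, detForm_apply,
    ← Matrix.det_submatrix_equiv_self finSumFinEquiv]
  have hM : (Matrix.of fun i j => (Fin.append (coord n) (coordConj n)) i
      ((w ∘ finCongr (two_mul n).symm) j)).submatrix finSumFinEquiv finSumFinEquiv =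
      Matrix.fromBlocks (1 : Matrix (Fin n) (Fin n) ℂ) (Complex.I • 1) 1 (-(Complex.I • 1)) := by
    have h0 (k : Fin n) : w (finCongr (two_mul n).symm (Fin.castAdd n k)) =
        EuclideanSpace.single k 1 := by
      have : finCongr (two_mul n).symm (Fin.castAdd n k) = finProdFinEquiv ((0 : Fin 2), k) := by
        ext; simp
      simp only [w, this, Equiv.symm_apply_apply]
      simp
    have h1 (k : Fin n) : w (finCongr (two_mul n).symm (Fin.natAdd n k)) =
        Complex.I • EuclideanSpace.single k 1 := by
      have : finCongr (two_mul n).symm (Fin.natAdd n k) = finProdFinEquiv ((1 : Fin 2), k) := by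
        ext; simp [add_comm]
      simp only [w, this, Equiv.symm_apply_apply]
      simp
    ext (i | i) (j | j) <;>
      simp [h0, h1, -finCongr_apply, -Fin.natAdd_eq_addNat, coord, coordConj, Matrix.one_apply,
        apply_ite]
    tauto
  rw [hM, Matrix.det_fromBlocks_one₁₁, one_mul,
    show -(Complex.I • (1 : Matrix (Fin n) (Fin n) ℂ)) - Complex.I • 1 = (-2 * Complex.I) • 1 by
      module, Matrix.det_smul, Matrix.det_one, Fintype.card_fin, mul_one, Units.smul_def,
    zsmul_eq_mul]
  push_cast
  ring

/-! ### Hermitian inner products on `ℂⁿ` -/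

/-- `B` is a real inner product on `ℂⁿ` that is invariant under multiplication by `i`. -/
structure IsHermitianInner {n : ℕ} (B : Cn n →L[ℝ] Cn n →L[ℝ] ℝ) : Prop where
  symm : ∀ v w, B v w = B w v
  pos : ∀ v, v ≠ 0 → 0 < B v v
  inner_I : ∀ v w, B (Complex.I • v) (Complex.I • w) = B v w

/-- The determinant of the Gram matrix of `B` in the basis `e₁, i e₁, …, eₙ, i eₙ`. -/
def gramDet {n : ℕ} (B : Cn n →L[ℝ] Cn n →L[ℝ] ℝ) : ℝ :=
  Matrix.det (Matrix.of fun i j => B (stdRealBasis n i) (stdRealBasis n j))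

theorem gramDet_bilinearComp {n : ℕ} (B : Cn n →L[ℝ] Cn n →L[ℝ] ℝ) (L : Cn n →L[ℝ] Cn n) :
    gramDet (B.bilinearComp L L) = LinearMap.det L.toLinearMap ^ 2 * gramDet B := by
  let B' : LinearMap.BilinForm ℝ (Cn n) := B.toLinearMap₁₂
  have h1 : gramDet B = (LinearMap.BilinForm.toMatrix (stdRealBasis n) B').det := by
    rw [gramDet]; congr 1; ext i j; simp [B', LinearMap.BilinForm.toMatrix_apply]
  have h2 : gramDet (B.bilinearComp L L) =
      (LinearMap.BilinForm.toMatrix (stdRealBasis n) (B'.comp L.toLinearMap L.toLinearMap)).det := by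
    rw [gramDet]; congr 1; ext i j; simp [B', LinearMap.BilinForm.toMatrix_apply]
  rw [h1, h2, LinearMap.BilinForm.toMatrix_comp (stdRealBasis n) (stdRealBasis n), Matrix.det_mul,
    Matrix.det_mul, Matrix.det_transpose, LinearMap.det_toMatrix]
  ring

theorem det_restrictScalars_complex {n : ℕ} (L : Cn n →L[ℂ] Cn n) :
    LinearMap.det (L.restrictScalars ℝ).toLinearMap = ‖LinearMap.det L.toLinearMap‖ ^ 2 := by
  have h := LinearMap.det_restrictScalars (R := ℝ) (f := L.toLinearMap)
  rw [Algebra.norm_complex_apply, Complex.normSq_eq_norm_sq] at h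
  exact h

namespace IsHermitianInner

variable {n : ℕ} {B : Cn n →L[ℝ] Cn n →L[ℝ] ℝ}

theorem inner_I_right (hB : IsHermitianInner B) (v w : Cn n) :
    B v (Complex.I • w) = -B (Complex.I • v) w := by
  have h := hB.inner_I v (Complex.I • w)
  rw [smul_smul, Complex.I_mul_I, neg_one_smul, map_neg] at h
  exact h.symm

/-- Gram–Schmidt for the Hermitian product `B(v, w) + i B(iv, w)`, which is conjugate linear in `v`.
-/
theorem exists_unitary_basis (hB : IsHermitianInner B) :
    ∃ u : Module.Basis (Fin n) ℂ (Cn n), ∀ j k, B (u j) (u k) = (if j = k then 1 else 0) ∧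
      B (Complex.I • u j) (u k) = 0 := by
  -- An abstract `V` is used because `Cn n` already carries an inner product, which would compete
  -- with the one built from `B`.
  have key : ∀ (V : Type) [AddCommGroup V] [Module ℂ V] [FiniteDimensional ℂ V]
      (_ : Module.finrank ℂ V = n) (c : InnerProductSpace.Core ℂ V),
      ∃ u : Module.Basis (Fin n) ℂ V, ∀ j k, c.inner (u j) (u k) = if j = k then 1 else 0 := by
    intro V _ _ _ hV c
    let : NormedAddCommGroup V := c.toNormedAddCommGroup
    let : InnerProductSpace ℂ V := InnerProductSpace.ofCore c.toCore
    let u := (stdOrthonormalBasis ℂ V).reindex (finCongr hV)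
    refine ⟨u.toBasis, fun j k => ?_⟩
    have := orthonormal_iff_ite.mp u.orthonormal j k
    rw [← u.coe_toBasis] at this
    exact this
  let c : InnerProductSpace.Core ℂ (Cn n) :=
    { inner := fun v w => ⟨B v w, B (Complex.I • v) w⟩
      conj_inner_symm := fun v w => by
        apply Complex.ext
        · simpa using hB.symm w v
        · simp only [Complex.conj_im]
          rw [hB.symm (Complex.I • w) v, hB.inner_I_right, neg_neg]
      re_inner_nonneg := fun v => by
        by_cases hv : v = 0
        · simp [hv]
        · exact (hB.pos v hv).le
      add_left := fun v w z => by
        apply Complex.ext <;> simp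
      smul_left := fun v w a => by
        have ha : a • v = a.re • v + a.im • (Complex.I • v) := by
          conv_lhs => rw [← Complex.re_add_im a, add_smul, mul_smul]
          rfl
        have ha' : Complex.I • a • v = a.re • (Complex.I • v) - a.im • v := by
          rw [ha, smul_add, smul_comm Complex.I a.re, smul_comm Complex.I a.im, smul_smul,
            Complex.I_mul_I, neg_one_smul, smul_neg, sub_eq_add_neg]
        apply Complex.ext
        · simp [ha]
        · simp only [ha']
          simp
          ring
      definite := fun v hv => by
        by_contra h
        have := hB.pos v h
        rw [Complex.ext_iff] at hv
        exact this.ne' hv.1 }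
  obtain ⟨u, hu⟩ := key (Cn n) (by simp) c
  refine ⟨u, fun j k => ?_⟩
  have h := Complex.ext_iff.mp (hu j k)
  refine ⟨h.1.trans ?_, h.2.trans ?_⟩ <;> split_ifs <;> rfl

/-- The real-bilinear form `B` has an orthonormal basis of the form `u₁, i u₁, …, uₙ, i uₙ`, the
image of the standard basis under a complex linear map. -/
theorem exists_unitary_map (hB : IsHermitianInner B) :
    ∃ L : Cn n →L[ℂ] Cn n, 0 < LinearMap.det (L.restrictScalars ℝ).toLinearMap ∧
      ∀ i j, B (L (stdRealBasis n i)) (L (stdRealBasis n j)) = if i = j then 1 else 0 := by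
  obtain ⟨u, hu⟩ := hB.exists_unitary_basis
  let L : Cn n ≃ₗ[ℂ] Cn n := (EuclideanSpace.basisFun (Fin n) ℂ).toBasis.equiv u (Equiv.refl _)
  refine ⟨LinearMap.toContinuousLinearMap L.toLinearMap, ?_, fun i j => ?_⟩
  · rw [det_restrictScalars_complex]
    have : LinearMap.det L.toLinearMap ≠ 0 := L.isUnit_det'.ne_zero
    have h := norm_pos_iff.mpr this
    exact pow_pos h 2
  · have hL (k : Fin n) : L (EuclideanSpace.single k 1) = u k := by
      have := (EuclideanSpace.basisFun (Fin n) ℂ).toBasis.equiv_apply k u (Equiv.refl _)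
      simpa using this
    obtain ⟨⟨k, ε⟩, rfl⟩ := (pairEquiv n).symm.surjective i
    obtain ⟨⟨l, δ⟩, rfl⟩ := (pairEquiv n).symm.surjective j
    simp only [LinearMap.coe_toContinuousLinearMap', stdRealBasis_apply, Equiv.apply_symm_apply,
      LinearEquiv.coe_coe, map_smul, hL, EmbeddingLike.apply_eq_iff_eq, Prod.mk.injEq]
    fin_cases ε <;> fin_cases δ <;>
      simp [hB.inner_I, hB.inner_I_right, (hu _ _).1, (hu _ _).2]

theorem sqrt_gramDet_mul_det {L : Cn n →L[ℝ] Cn n}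
    (hL : 0 < LinearMap.det L.toLinearMap)
    (hBL : ∀ i j, B (L (stdRealBasis n i)) (L (stdRealBasis n j)) = if i = j then 1 else 0) :
    √(gramDet B) * LinearMap.det L.toLinearMap = 1 := by
  have h : gramDet (B.bilinearComp L L) = 1 := by
    rw [gramDet, ← Matrix.det_one (n := Fin (2 * n))]
    congr 1
    ext i j
    simpa [Matrix.one_apply] using hBL i j
  rw [gramDet_bilinearComp] at h
  rw [← Real.sqrt_sq hL.le, ← Real.sqrt_mul' _ (sq_nonneg _), mul_comm, h, Real.sqrt_one]

theorem gramDet_pos (hB : IsHermitianInner B) : 0 < gramDet B := by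
  obtain ⟨L, hL, hBL⟩ := hB.exists_unitary_map
  have := sqrt_gramDet_mul_det hL hBL
  by_contra! h
  rw [Real.sqrt_eq_zero_of_nonpos h, zero_mul] at this
  exact zero_ne_one this

/-- Let `r` be a unitary frame. In its dual frame `c`, `Ω` is `∑ c_{k,0} ∧ c_{k,1}`, so `Ωⁿ` is `n!`
times the product of all the `c_{k,ε}`. Both sides have top degree and take the value `1` on `r`. -/
theorem sqrt_gramDet_smul_det (hB : IsHermitianInner B) (Ω : Cn n [⋀^Fin 2]→ₗ[ℝ] ℝ)
    (hΩ : ∀ v, Ω v = B (Complex.I • v 0) (v 1)) :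
    √(gramDet B) • (stdRealBasis n).det = (n.factorial : ℝ)⁻¹ • wedgePow Ω n := by
  obtain ⟨L, hL, hBL⟩ := hB.exists_unitary_map
  let r : Fin (2 * n) → Cn n := fun i => L (stdRealBasis n i)
  let Le : Cn n ≃ₗ[ℝ] Cn n := LinearEquiv.ofIsUnitDet (f := (L.restrictScalars ℝ).toLinearMap)
    (v := stdRealBasis n) (v' := stdRealBasis n) (by rw [LinearMap.det_toMatrix]; exact hL.ne'.isUnit)
  let rb : Module.Basis (Fin (2 * n)) ℝ (Cn n) := (stdRealBasis n).map Le
  have hrb (i) : rb i = r i := rfl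
  let c (k : Fin n) (ε : Fin 2) : Cn n →ₗ[ℝ] ℝ := (B (r ((pairEquiv n).symm (k, ε)))).toLinearMap
  have hI0 (k : Fin n) : Complex.I • r ((pairEquiv n).symm (k, 0)) =
      r ((pairEquiv n).symm (k, 1)) := by
    simp [r, stdRealBasis_apply]
  have hI1 (k : Fin n) : Complex.I • r ((pairEquiv n).symm (k, 1)) =
      -r ((pairEquiv n).symm (k, 0)) := by
    rw [← hI0, smul_smul, Complex.I_mul_I, neg_one_smul]
  have hΩc : Ω = ∑ k, detForm (c k) := by
    refine Module.Basis.ext_alternating rb fun v _ => ?_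
    have hB1 (i j) : B (r i) (r j) = if i = j then 1 else 0 := hBL i j
    obtain ⟨⟨k, ε⟩, hk⟩ := (pairEquiv n).symm.surjective (v 0)
    obtain ⟨⟨l, δ⟩, hl⟩ := (pairEquiv n).symm.surjective (v 1)
    have hsum (w : Fin 2 → Cn n) : (∑ k, detForm (c k)) w = ∑ k, detForm (c k) w :=
      (congrArg (fun m => m w) (map_sum (AlternatingMap.toMultilinearMapLM (S := ℕ))
        (fun k => detForm (c k)) _)).trans (sum_apply _ _ _)
    rw [hΩ, hsum]
    simp only [detForm_apply, Matrix.det_fin_two, Matrix.of_apply, hrb, c,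
      ContinuousLinearMap.coe_coe, ← hk, ← hl]
    fin_cases ε <;> fin_cases δ <;>
      simp [hI0, hI1, hB1, eq_comm]
  have hf (f : Cn n [⋀^Fin (2 * n)]→ₗ[ℝ] ℝ) : f = f r • rb.det := f.eq_smul_basis_det rb
  rw [hf (√(gramDet B) • (stdRealBasis n).det), hf ((n.factorial : ℝ)⁻¹ • wedgePow Ω n)]
  congr 1
  have h1 : (stdRealBasis n).det r = LinearMap.det (L.restrictScalars ℝ).toLinearMap := by
    have := (stdRealBasis n).det_comp (L.restrictScalars ℝ).toLinearMap (stdRealBasis n)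
    rw [Module.Basis.det_self, mul_one] at this
    exact this
  rw [AlternatingMap.smul_apply, AlternatingMap.smul_apply, h1, hΩc, wedgePow_sum_detForm_self,
    AlternatingMap.smul_apply, detForm_apply, smul_eq_mul, sqrt_gramDet_mul_det hL hBL, smul_smul,
    inv_mul_cancel₀ (by positivity), one_smul, ← Matrix.det_one (n := Fin (2 * n))]
  congr 1
  ext i j
  simpa [Matrix.one_apply, c, r] using (hBL i j).symm

end IsHermitianInner

/-! ### Complex volume forms on `ℂⁿ` -/

/-- The coefficient of an alternating form of top degree on `ℂⁿ`. -/
def topCoeff {n : ℕ} (α : Cn n [⋀^Fin n]→L[ℂ] ℂ) : ℂ := α fun k => EuclideanSpace.single k 1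

theorem restrictScalars_eq_topCoeff_smul {n : ℕ} (α : Cn n [⋀^Fin n]→L[ℂ] ℂ) :
    (α.restrictScalars ℝ : Cn n [⋀^Fin n]→L[ℝ] ℂ).toAlternatingMap =
      topCoeff α • detForm (coord n) := by
  let e := (EuclideanSpace.basisFun (Fin n) ℂ).toBasis
  have h := α.toAlternatingMap.eq_smul_basis_det e
  ext v
  have hv := congrArg (fun β => β v) h
  rw [AlternatingMap.smul_apply, detForm_apply]
  refine hv.trans ?_
  rw [AlternatingMap.smul_apply, Module.Basis.det_apply]
  have he : (e : Fin n → Cn n) = fun k => EuclideanSpace.single k 1 := by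
    funext k; simp [e]
  rw [he]
  rfl

theorem wedge_conjForm_eq {n : ℕ} (α : Cn n [⋀^Fin n]→L[ℂ] ℂ) :
    wedge (α.restrictScalars ℝ : Cn n [⋀^Fin n]→L[ℝ] ℂ).toAlternatingMap
      (conjForm (α.restrictScalars ℝ : Cn n [⋀^Fin n]→L[ℝ] ℂ).toAlternatingMap) =
      ((‖topCoeff α‖ ^ 2 : ℝ) : ℂ) • detForm (Fin.append (coord n) (coordConj n)) := by
  have h : conjForm (detForm (coord n)) = detForm (coordConj n) := by
    ext v
    rw [detForm_apply]
    change starRingEnd ℂ (detForm (coord n) v) = _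
    rw [detForm_apply, RingHom.map_det]
    rfl
  have h' : conjForm (topCoeff α • detForm (coord n)) =
      starRingEnd ℂ (topCoeff α) • detForm (coordConj n) := by
    rw [← h]
    ext v
    exact map_mul (starRingEnd ℂ) _ _
  rw [restrictScalars_eq_topCoeff_smul, h', wedge_smul_smul, wedge_detForm, Complex.mul_conj,
    Complex.normSq_eq_norm_sq]

/-- Top-degree forms are determined by their value on one basis, so the required identity of forms
at a point is a single equation between real numbers. -/
theorem complexify_smul_det_eq_iff {n : ℕ} (s t : ℝ) (α : Cn n [⋀^Fin n]→L[ℂ] ℂ) :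
    complexify (s • (stdRealBasis n).det) = ((Complex.I ^ n / 2) ^ n * (t : ℂ)) •
      (wedge (α.restrictScalars ℝ : Cn n [⋀^Fin n]→L[ℝ] ℂ).toAlternatingMap
      (conjForm (α.restrictScalars ℝ : Cn n [⋀^Fin n]→L[ℝ] ℂ).toAlternatingMap)).domDomCongr
        (finCongr (two_mul n).symm) ↔ s = t * ‖topCoeff α‖ ^ 2 := by
  have hl : complexify (s • (stdRealBasis n).det) (stdRealBasis n) = s := by
    change ((s • (stdRealBasis n).det (stdRealBasis n) : ℝ) : ℂ) = s
    rw [Module.Basis.det_self, smul_eq_mul, mul_one]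
  have hr : (((Complex.I ^ n / 2) ^ n * (t : ℂ)) •
      (wedge (α.restrictScalars ℝ : Cn n [⋀^Fin n]→L[ℝ] ℂ).toAlternatingMap
      (conjForm (α.restrictScalars ℝ : Cn n [⋀^Fin n]→L[ℝ] ℂ).toAlternatingMap)).domDomCongr
        (finCongr (two_mul n).symm)) (stdRealBasis n) = ((t * ‖topCoeff α‖ ^ 2 : ℝ) : ℂ) := by
    have h := detForm_coord_coordConj_apply n
    rw [wedge_conjForm_eq, AlternatingMap.smul_apply]
    rw [AlternatingMap.domDomCongr_apply] at h ⊢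
    rw [AlternatingMap.smul_apply, h, smul_eq_mul, smul_eq_mul]
    have := I_pow_mul_prod n
    push_cast
    linear_combination (t : ℂ) * ‖topCoeff α‖ ^ 2 * this
  constructor
  · intro h
    rw [h, hr] at hl
    exact_mod_cast hl.symm
  · intro h
    refine Module.Basis.ext_alternating (stdRealBasis n) fun v hv => ?_
    let σ := Equiv.ofBijective v (Finite.injective_iff_bijective.mp hv)
    change complexify (s • (stdRealBasis n).det) (stdRealBasis n ∘ σ) =
      (((Complex.I ^ n / 2) ^ n * (t : ℂ)) • _ : Cn n [⋀^Fin (2 * n)]→ₗ[ℝ] ℂ)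
        (stdRealBasis n ∘ σ)
    rw [AlternatingMap.map_perm, AlternatingMap.map_perm, hl, hr, h]

/-! ### The derivative of the determinant -/

theorem contDiff_det_of {ι : Type*} [Fintype ι] [DecidableEq ι] :
    ContDiff ℝ ∞ fun A : ι → ι → ℝ => (Matrix.of A).det := by
  simp only [Matrix.det_apply, Units.smul_def, zsmul_eq_mul, Matrix.of_apply]
  fun_prop

/-- Jacobi's formula: along the line `A + tN = A (1 + t A⁻¹N)` the determinant is `det A (1 + t
tr(A⁻¹N) + O(t²))`, with a polynomial remainder. -/
theorem fderiv_det_of {ι : Type*} [Fintype ι] [DecidableEq ι] (A N : ι → ι → ℝ)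
    (hA : (Matrix.of A).det ≠ 0) :
    fderiv ℝ (fun A : ι → ι → ℝ => (Matrix.of A).det) A N =
      (Matrix.of A).det * ((Matrix.of A)⁻¹ * Matrix.of N).trace := by
  have hd : DifferentiableAt ℝ (fun A : ι → ι → ℝ => (Matrix.of A).det) A :=
    contDiff_det_of.differentiable (by simp) A
  have h1 : HasDerivAt (fun t : ℝ => (Matrix.of (A + t • N)).det)
      (fderiv ℝ (fun A : ι → ι → ℝ => (Matrix.of A).det) A N) 0 := by
    have hl : HasDerivAt (fun t : ℝ => A + t • N) N 0 := by
      simpa using ((hasDerivAt_id (0 : ℝ)).smul_const N).const_add A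
    have hd' : HasFDerivAt (fun A : ι → ι → ℝ => (Matrix.of A).det)
      (fderiv ℝ (fun A : ι → ι → ℝ => (Matrix.of A).det) A) (A + (0 : ℝ) • N) := by
      simpa using hd.hasFDerivAt
    exact hd'.comp_hasDerivAt 0 hl
  have h2 (t : ℝ) : (Matrix.of (A + t • N)).det =
      (Matrix.of A).det * (1 + ((Matrix.of A)⁻¹ * Matrix.of N).trace * t +
        (Matrix.det (1 + (Polynomial.X : Polynomial ℝ) •
          ((Matrix.of A)⁻¹ * Matrix.of N).map Polynomial.C)).divX.divX.eval t * t ^ 2) := by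
    rw [← Matrix.det_one_add_smul, ← Matrix.det_mul, mul_add, mul_one, mul_smul_comm,
      ← mul_assoc, Matrix.mul_nonsing_inv _ hA.isUnit, one_mul]
    rfl
  simp only [h2] at h1
  refine h1.unique ?_
  set p := (Matrix.det (1 + (Polynomial.X : Polynomial ℝ) •
          ((Matrix.of A)⁻¹ * Matrix.of N).map Polynomial.C)).divX.divX
  have hp := ((hasDerivAt_const (0 : ℝ) (1 : ℝ)).add
    ((hasDerivAt_id (0 : ℝ)).const_mul ((Matrix.of A)⁻¹ * Matrix.of N).trace)).add
      ((p.hasDerivAt 0).mul ((hasDerivAt_id (0 : ℝ)).pow 2))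
  simpa using hp.const_mul (Matrix.of A).det

theorem Matrix.trace_mul_eq_zero_of_symm_of_antisymm {ι : Type*} [Fintype ι]
    {P S : Matrix ι ι ℝ} (hP : P.transpose = P) (hS : S.transpose = -S) : (P * S).trace = 0 := by
  have h := Matrix.trace_transpose (P * S)
  rw [Matrix.transpose_mul, hP, hS, Matrix.neg_mul, Matrix.trace_neg, Matrix.trace_mul_comm] at h
  linarith

/-! ### Kähler metrics on open subsets of `ℂⁿ` -/

/-- `G` is a smooth Kähler metric on the open subset `U` of `ℂⁿ`. -/
structure IsKahlerMetricOn {n : ℕ} (G : Cn n → Cn n →L[ℝ] Cn n →L[ℝ] ℝ) (U : Set (Cn n)) :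
    Prop where
  isOpen : IsOpen U
  contDiffOn : ContDiffOn ℝ ∞ G U
  isHermitianInner : ∀ y ∈ U, IsHermitianInner (G y)
  closed : ∀ y ∈ U, ∀ u v w, fderiv ℝ G y u (Complex.I • v) w -
    fderiv ℝ G y v (Complex.I • u) w + fderiv ℝ G y w (Complex.I • u) v = 0

namespace IsKahlerMetricOn

variable {n : ℕ} {G : Cn n → Cn n →L[ℝ] Cn n →L[ℝ] ℝ} {U : Set (Cn n)} {y : Cn n}

theorem contDiffAt (hG : IsKahlerMetricOn G U) (hy : y ∈ U) : ContDiffAt ℝ ∞ G y :=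
  hG.contDiffOn.contDiffAt (hG.isOpen.mem_nhds hy)

theorem differentiableAt (hG : IsKahlerMetricOn G U) (hy : y ∈ U) : DifferentiableAt ℝ G y :=
  (hG.contDiffAt hy).differentiableAt (by simp)

theorem fderiv_apply_apply (hG : IsKahlerMetricOn G U) (hy : y ∈ U) (u v w : Cn n) :
    fderiv ℝ G y u v w = fderiv ℝ (fun z => G z v w) y u := by
  have h : HasFDerivAt (fun z => G z v w) (((fderiv ℝ G y).flip v).flip w) y :=
    ((hG.differentiableAt hy).hasFDerivAt.clm_apply (hasFDerivAt_const v y)).clm_apply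
      (hasFDerivAt_const w y) |>.congr_fderiv (by ext; simp)
  rw [h.fderiv]
  rfl

/-! ### Parallelism of the complex structure -/

theorem fderiv_symm (hG : IsKahlerMetricOn G U) (hy : y ∈ U) (u v w : Cn n) :
    fderiv ℝ G y u v w = fderiv ℝ G y u w v := by
  rw [hG.fderiv_apply_apply hy, hG.fderiv_apply_apply hy]
  congr 1
  refine Filter.EventuallyEq.fderiv_eq ?_
  filter_upwards [hG.isOpen.mem_nhds hy] with z hz using (hG.isHermitianInner z hz).symm v w

theorem fderiv_inner_I_right (hG : IsKahlerMetricOn G U) (hy : y ∈ U) (u v w : Cn n) :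
    fderiv ℝ G y u v (Complex.I • w) = -fderiv ℝ G y u (Complex.I • v) w := by
  rw [hG.fderiv_apply_apply hy, hG.fderiv_apply_apply hy, ← neg_apply, ← fderiv_fun_neg]
  congr 1
  refine Filter.EventuallyEq.fderiv_eq ?_
  filter_upwards [hG.isOpen.mem_nhds hy] with z hz using
    (hG.isHermitianInner z hz).inner_I_right v w

/-- This is `∇J = 0` before raising an index. As `J` is constant in the chart, it is the difference
of `dΩ = 0` at `(iv, u, iw)` and at `(v, u, w)`, up to the symmetries of the differentiated metric.
-/
theorem christoffelFirst_I (hG : IsKahlerMetricOn G U) (hy : y ∈ U) (u v w : Cn n) :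
    christoffelFirst G y u (Complex.I • v) w = -christoffelFirst G y u v (Complex.I • w) := by
  have hI (w : Cn n) : Complex.I • (Complex.I • w) = -w := by
    rw [smul_smul, Complex.I_mul_I, neg_one_smul]
  rw [christoffelFirst_apply, christoffelFirst_apply]
  have h1 := hG.closed y hy v u w
  have h2 := hG.closed y hy (Complex.I • v) u (Complex.I • w)
  simp only [hI, map_neg, neg_apply, hG.fderiv_inner_I_right hy] at h1 h2 ⊢
  have e1 := hG.fderiv_symm hy
  have e2 := hG.fderiv_inner_I_right hy
  rw [e1 u (Complex.I • v) w] at *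
  have s1 := e1 w (Complex.I • v) u
  have s2 := e1 v (Complex.I • u) w
  have s3 := e1 u (Complex.I • w) v
  have s4 := e1 (Complex.I • v) u w
  have s5 := e1 (Complex.I • w) u v
  have t1 := e2 w u v
  have t2 := e2 v w u
  have t3 := e2 u v w
  have t4 := e2 u w v
  have s6 := e1 u w v
  simp only [hI] at *
  linarith

/-- `christoffel` uses `ContinuousLinearMap.inverse`, which is zero on non-invertible maps;
nondegeneracy makes it the true inverse. -/
theorem isInvertible (hG : IsKahlerMetricOn G U) (hy : y ∈ U) : (G y).IsInvertible := by
  have hinj : Function.Injective (G y).toLinearMap := by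
    rw [← LinearMap.ker_eq_bot, LinearMap.ker_eq_bot']
    intro v hv
    by_contra h
    have := (hG.isHermitianInner y hy).pos v h
    have h0 : G y v = 0 := hv
    simp [h0] at this
  have hdim : Module.finrank ℝ (Cn n) = Module.finrank ℝ (Cn n →L[ℝ] ℝ) := by
    rw [← (LinearMap.toContinuousLinearMap : (Cn n →ₗ[ℝ] ℝ) ≃ₗ[ℝ] _).finrank_eq]
    exact (Subspace.dual_finrank_eq).symm
  let e := ((G y).toLinearMap.linearEquivOfInjective hinj hdim).toContinuousLinearEquiv
  exact ⟨e, by ext; rfl⟩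

theorem apply_christoffel (hG : IsKahlerMetricOn G U) (hy : y ∈ U) (u v w : Cn n) :
    G y (christoffel G y u v) w = christoffelFirst G y u v w := by
  have : G y ((G y).inverse (christoffelFirst G y u v)) = christoffelFirst G y u v :=
    (hG.isInvertible hy).self_apply_inverse _
  exact congrArg (fun l => l w) this

theorem eq_of_apply_eq (hG : IsKahlerMetricOn G U) (hy : y ∈ U) {a b : Cn n}
    (h : ∀ w, G y a w = G y b w) : a = b := by
  by_contra hab
  have := (hG.isHermitianInner y hy).pos (a - b) (sub_ne_zero.mpr hab)
  simp [h] at this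

theorem christoffel_symm (hG : IsKahlerMetricOn G U) (hy : y ∈ U) (u v : Cn n) :
    christoffel G y u v = christoffel G y v u := by
  refine hG.eq_of_apply_eq hy fun w => ?_
  rw [hG.apply_christoffel hy, hG.apply_christoffel hy, christoffelFirst_apply,
    christoffelFirst_apply, hG.fderiv_symm hy w u v]
  ring

theorem christoffel_I_right (hG : IsKahlerMetricOn G U) (hy : y ∈ U) (u v : Cn n) :
    christoffel G y u (Complex.I • v) = Complex.I • christoffel G y u v := by
  refine hG.eq_of_apply_eq hy fun w => ?_
  rw [hG.apply_christoffel hy, hG.christoffelFirst_I hy, ← hG.apply_christoffel hy,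
    (hG.isHermitianInner y hy).inner_I_right, neg_neg]

theorem christoffel_I_left (hG : IsKahlerMetricOn G U) (hy : y ∈ U) (u v : Cn n) :
    christoffel G y (Complex.I • u) v = Complex.I • christoffel G y u v := by
  rw [hG.christoffel_symm hy, hG.christoffel_I_right hy, hG.christoffel_symm hy]

theorem differentiableAt_christoffel (hG : IsKahlerMetricOn G U) (hy : y ∈ U) :
    DifferentiableAt ℝ (christoffel G) y := by
  have hD : DifferentiableAt ℝ (fderiv ℝ G) y :=
    ((hG.contDiffAt hy).fderiv_right (m := 1) (by norm_cast)).differentiableAt (by simp)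
  have hflip : DifferentiableAt ℝ (fun z => (fderiv ℝ G z).flip) y :=
    (ContinuousLinearMap.flipₗᵢ ℝ (Cn n) (Cn n)
      (Cn n →L[ℝ] ℝ)).toContinuousLinearEquiv.toContinuousLinearMap.differentiableAt.comp y hD
  have hfirst : DifferentiableAt ℝ (christoffelFirst G) y := by
    have h := (ContinuousLinearMap.compL ℝ (Cn n) (Cn n →L[ℝ] Cn n →L[ℝ] ℝ)
      (Cn n →L[ℝ] Cn n →L[ℝ] ℝ) (ContinuousLinearMap.flipₗᵢ ℝ (Cn n) (Cn n)
        ℝ).toContinuousLinearEquiv.toContinuousLinearMap).differentiableAt.comp y hflip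
    exact ((hD.add hflip).sub h).const_smul (2⁻¹ : ℝ)
  have hinv : DifferentiableAt ℝ (fun z => (G z).inverse) y := by
    obtain ⟨e, he⟩ := hG.isInvertible hy
    have h : ContDiffAt ℝ 1 ContinuousLinearMap.inverse (G y) := by
      rw [← he]; exact contDiffAt_map_inverse e
    exact (h.differentiableAt (by simp)).comp y (hG.differentiableAt hy)
  have hc : DifferentiableAt ℝ (fun z => ContinuousLinearMap.compL ℝ (Cn n) (Cn n →L[ℝ] ℝ) (Cn n)
      (G z).inverse) y :=
    (ContinuousLinearMap.compL ℝ (Cn n) (Cn n →L[ℝ] ℝ) (Cn n)).differentiableAt.comp y hinv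
  exact hc.clm_comp hfirst

/-! ### Derivatives of the volume density -/

theorem contDiffAt_gram (hG : IsKahlerMetricOn G U) (hy : y ∈ U) :
    ContDiffAt ℝ ∞ (fun z i j => G z (stdRealBasis n i) (stdRealBasis n j)) y := by
  have := hG.contDiffAt hy
  fun_prop

theorem contDiffAt_gramDet (hG : IsKahlerMetricOn G U) (hy : y ∈ U) :
    ContDiffAt ℝ ∞ (fun z => gramDet (G z)) y :=
  contDiff_det_of.contDiffAt.comp y (hG.contDiffAt_gram hy)

/-- With `A` the Gram matrix and `C` the matrix of `Γ(w, ·)`, the Koszul formula reads `A C = (N +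
S) / 2`, where `N` is the derivative of `A` along `w` and `S` is antisymmetric. Since `A⁻¹` is
symmetric, `A⁻¹S` has trace zero, and Jacobi's formula applies to `N`. -/
theorem fderiv_gramDet (hG : IsKahlerMetricOn G U) (hy : y ∈ U) (w : Cn n) :
    fderiv ℝ (fun z => gramDet (G z)) y w =
      2 * gramDet (G y) * LinearMap.trace ℝ (Cn n) (christoffel G y w).toLinearMap := by
  let b := stdRealBasis n
  let A (i j : Fin (2 * n)) : ℝ := G y (b i) (b j)
  let N (i j : Fin (2 * n)) : ℝ := fderiv ℝ G y w (b i) (b j)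
  let S (i j : Fin (2 * n)) : ℝ := fderiv ℝ G y (b j) w (b i) - fderiv ℝ G y (b i) w (b j)
  let C := LinearMap.toMatrix b b (christoffel G y w).toLinearMap
  have hA : (Matrix.of A).det ≠ 0 := (hG.isHermitianInner y hy).gramDet_pos.ne'
  have hAC : Matrix.of A * C = (2⁻¹ : ℝ) • (Matrix.of N + Matrix.of S) := by
    ext i j
    have h : christoffel G y w (b j) = ∑ k, C k j • b k := by
      rw [← b.sum_repr (christoffel G y w (b j))]
      refine Finset.sum_congr rfl fun k _ => ?_
      exact congrArg (· • b k) (LinearMap.toMatrix_apply b b _ k j).symm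
    have h1 : G y (b i) (christoffel G y w (b j)) = ∑ k, A i k * C k j := by
      rw [h, map_sum]
      simp [A, mul_comm]
    rw [Matrix.mul_apply]
    refine h1.symm.trans ?_
    rw [(hG.isHermitianInner y hy).symm, hG.apply_christoffel hy, christoffelFirst_apply,
      hG.fderiv_symm hy w]
    simp only [N, S, Matrix.smul_apply, Matrix.add_apply, Matrix.of_apply, smul_eq_mul]
    ring
  have htr : ((Matrix.of A)⁻¹ * Matrix.of S).trace = 0 := by
    refine Matrix.trace_mul_eq_zero_of_symm_of_antisymm ?_ ?_
    · rw [Matrix.transpose_nonsing_inv]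
      congr 1
      ext i j
      exact (hG.isHermitianInner y hy).symm _ _
    · ext i j
      simp [S]
  have hC : 2 * C.trace = ((Matrix.of A)⁻¹ * Matrix.of N).trace := by
    have : C = (Matrix.of A)⁻¹ * (Matrix.of A * C) := by
      rw [← mul_assoc, Matrix.nonsing_inv_mul _ hA.isUnit, one_mul]
    rw [this, hAC, mul_smul_comm, mul_add, Matrix.trace_smul, Matrix.trace_add, htr, smul_eq_mul]
    ring
  have hM := (hG.contDiffAt_gram hy).differentiableAt (by simp)
  have hcomp : fderiv ℝ (fun z => gramDet (G z)) y w =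
      fderiv ℝ (fun A : Fin (2 * n) → Fin (2 * n) → ℝ => (Matrix.of A).det) A
        (fderiv ℝ (fun z i j => G z (b i) (b j)) y w) := by
    have := fderiv_comp (𝕜 := ℝ) y
      ((contDiff_det_of (ι := Fin (2 * n))).differentiable (by simp) A) hM
    exact congrArg (fun l => l w) this
  have hN : fderiv ℝ (fun z i j => G z (b i) (b j)) y w = N := by
    funext i j
    have := (((ContinuousLinearMap.proj j : (Fin (2 * n) → ℝ) →L[ℝ] ℝ) ∘L
      (ContinuousLinearMap.proj i : (Fin (2 * n) → Fin (2 * n) → ℝ) →L[ℝ] _)).hasFDerivAt.comp y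
        hM.hasFDerivAt).fderiv
    exact (congrArg (fun l => l w) this).symm.trans (hG.fderiv_apply_apply hy w (b i) (b j)).symm
  rw [hcomp, hN, fderiv_det_of A N hA, ← hC, ← LinearMap.trace_eq_matrix_trace]
  change gramDet (G y) * _ = _
  ring

/-- The trace of an endomorphism, as a continuous linear map. -/
def traceCLM (n : ℕ) : (Cn n →L[ℝ] Cn n) →L[ℝ] ℝ :=
  LinearMap.toContinuousLinearMap
    (LinearMap.trace ℝ (Cn n) ∘ₗ LinearMap.toContinuousLinearMap.symm.toLinearMap)

theorem traceCLM_apply (A : Cn n →L[ℝ] Cn n) :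
    traceCLM n A = LinearMap.trace ℝ (Cn n) A.toLinearMap := rfl

theorem contDiffAt_log_sqrt_gramDet (hG : IsKahlerMetricOn G U) (hy : y ∈ U) :
    ContDiffAt ℝ ∞ (fun z => Real.log √(gramDet (G z))) y := by
  have hpos := (hG.isHermitianInner y hy).gramDet_pos
  exact ((hG.contDiffAt_gramDet hy).sqrt hpos.ne').log (Real.sqrt_pos.mpr hpos).ne'

theorem fderiv_log_sqrt_gramDet (hG : IsKahlerMetricOn G U) (hy : y ∈ U) (w : Cn n) :
    fderiv ℝ (fun z => Real.log √(gramDet (G z))) y w = traceCLM n (christoffel G y w) := by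
  have hpos := (hG.isHermitianInner y hy).gramDet_pos
  have h1 : (fun z => Real.log √(gramDet (G z))) =ᶠ[nhds y]
      fun z => Real.log (gramDet (G z)) / 2 := by
    filter_upwards [hG.isOpen.mem_nhds hy] with z hz
    exact Real.log_sqrt (hG.isHermitianInner z hz).gramDet_pos.le
  have hd := ((hG.contDiffAt_gramDet hy).differentiableAt (by simp)).hasFDerivAt
  have h2 := (hd.log hpos.ne').mul_const (2⁻¹ : ℝ)
  simp only [← div_eq_mul_inv] at h2
  rw [h1.fderiv_eq, h2.fderiv, smul_apply, smul_apply, hG.fderiv_gramDet hy, traceCLM_apply]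
  simp only [smul_eq_mul]
  field_simp

theorem fderiv_fderiv_log_sqrt_gramDet (hG : IsKahlerMetricOn G U) (hy : y ∈ U) (v w : Cn n) :
    fderiv ℝ (fderiv ℝ fun z => Real.log √(gramDet (G z))) y v w =
      traceCLM n (fderiv ℝ (christoffel G) y v w) := by
  have hd : DifferentiableAt ℝ (fderiv ℝ fun z => Real.log √(gramDet (G z))) y :=
    ((hG.contDiffAt_log_sqrt_gramDet hy).fderiv_right (m := 1) (by norm_cast)).differentiableAt
      (by simp)
  have h1 := (hd.hasFDerivAt.clm_apply (hasFDerivAt_const w y)).fderiv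
  have h2 := ((traceCLM n).hasFDerivAt.comp y
    ((hG.differentiableAt_christoffel hy).hasFDerivAt.clm_apply (hasFDerivAt_const w y))).fderiv
  have h3 : (fun z => fderiv ℝ (fun z => Real.log √(gramDet (G z))) z w) =ᶠ[nhds y]
      (traceCLM n) ∘ fun z => christoffel G z w := by
    filter_upwards [hG.isOpen.mem_nhds hy] with z hz using hG.fderiv_log_sqrt_gramDet hz w
  rw [h3.fderiv_eq, h2] at h1
  simpa using (congrArg (fun l => l v) h1).symm

/-! ### Ricci curvature of a Kähler metric -/

theorem fderiv_christoffel_apply_apply (hG : IsKahlerMetricOn G U) (hy : y ∈ U) (u v w : Cn n) :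
    fderiv ℝ (christoffel G) y u v w = fderiv ℝ (fun z => christoffel G z v w) y u := by
  have h : HasFDerivAt (fun z => christoffel G z v w)
      (((fderiv ℝ (christoffel G) y).flip v).flip w) y :=
    ((hG.differentiableAt_christoffel hy).hasFDerivAt.clm_apply (hasFDerivAt_const v y)).clm_apply
      (hasFDerivAt_const w y) |>.congr_fderiv (by ext; simp)
  rw [h.fderiv]
  rfl

theorem fderiv_christoffel_symm (hG : IsKahlerMetricOn G U) (hy : y ∈ U) (u v w : Cn n) :
    fderiv ℝ (christoffel G) y u v w = fderiv ℝ (christoffel G) y u w v := by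
  rw [hG.fderiv_christoffel_apply_apply hy, hG.fderiv_christoffel_apply_apply hy]
  congr 1
  refine Filter.EventuallyEq.fderiv_eq ?_
  filter_upwards [hG.isOpen.mem_nhds hy] with z hz using hG.christoffel_symm hz v w

theorem christoffel_I_I (hG : IsKahlerMetricOn G U) (hy : y ∈ U) (v w : Cn n) :
    christoffel G y (Complex.I • v) (Complex.I • w) = -christoffel G y v w := by
  rw [hG.christoffel_I_right hy, hG.christoffel_I_left hy, smul_smul, Complex.I_mul_I,
    neg_one_smul]

theorem fderiv_christoffel_I_I (hG : IsKahlerMetricOn G U) (hy : y ∈ U) (u v w : Cn n) :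
    fderiv ℝ (christoffel G) y u (Complex.I • v) (Complex.I • w) =
      -fderiv ℝ (christoffel G) y u v w := by
  rw [hG.fderiv_christoffel_apply_apply hy, hG.fderiv_christoffel_apply_apply hy, ← neg_apply,
    ← fderiv_fun_neg]
  congr 1
  refine Filter.EventuallyEq.fderiv_eq ?_
  filter_upwards [hG.isOpen.mem_nhds hy] with z hz using hG.christoffel_I_I hz v w

/-- Complex bilinearity of `Γ` makes every curvature term cancel between `(v, w)` and `(iv, iw)`
except `-∂_v Γ(u, w)`. By symmetry of `Γ`, its trace over `u` is minus a second derivative of `log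
√(det G)`. Summing the two pairs avoids proving that the Ricci tensor is itself `i`-invariant. -/
theorem ricci_add_ricci_I (hG : IsKahlerMetricOn G U) (hy : y ∈ U) (v w : Cn n) :
    ricci G y v w + ricci G y (Complex.I • v) (Complex.I • w) =
      -(fderiv ℝ (fderiv ℝ fun z => Real.log √(gramDet (G z))) y v w +
        fderiv ℝ (fderiv ℝ fun z => Real.log √(gramDet (G z))) y (Complex.I • v)
          (Complex.I • w)) := by
  rw [hG.fderiv_fderiv_log_sqrt_gramDet hy, hG.fderiv_fderiv_log_sqrt_gramDet hy, ricci, ricci,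
    ← traceCLM_apply, ← traceCLM_apply, ← map_add, ← map_add, ← map_neg]
  congr 1
  ext1 u
  have h1 : christoffel G y (Complex.I • v) (christoffel G y u (Complex.I • w)) =
      -christoffel G y v (christoffel G y u w) := by
    rw [hG.christoffel_I_right hy u, hG.christoffel_I_I hy]
  rw [add_apply, neg_apply, add_apply, curvature_apply, curvature_apply,
    hG.fderiv_christoffel_I_I hy, h1, hG.christoffel_I_I hy, map_neg,
    hG.fderiv_christoffel_symm hy v u, hG.fderiv_christoffel_symm hy (Complex.I • v) u]
  abel

/-- For a gradient Ricci soliton, `log √(det G) + f` is pluriharmonic. -/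
theorem pluriharmonic_of_ricci_eq_hessian (hG : IsKahlerMetricOn G U) {f : Cn n → ℝ}
    (hf : ContDiffOn ℝ ∞ f U)
    (hric : ∀ y ∈ U, ∀ v w, ricci G y v w = hessian G f y v w) (hy : y ∈ U) (v w : Cn n) :
    fderiv ℝ (fderiv ℝ fun z => Real.log √(gramDet (G z)) + f z) y v w +
      fderiv ℝ (fderiv ℝ fun z => Real.log √(gramDet (G z)) + f z) y (Complex.I • v)
        (Complex.I • w) = 0 := by
  have hfy (z) (hz : z ∈ U) : ContDiffAt ℝ ∞ f z := hf.contDiffAt (hG.isOpen.mem_nhds hz)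
  have hadd : fderiv ℝ (fderiv ℝ fun z => Real.log √(gramDet (G z)) + f z) y =
      fderiv ℝ (fderiv ℝ fun z => Real.log √(gramDet (G z))) y + fderiv ℝ (fderiv ℝ f) y := by
    rw [← fderiv_add]
    · refine Filter.EventuallyEq.fderiv_eq ?_
      filter_upwards [hG.isOpen.mem_nhds hy] with z hz
      exact fderiv_add ((hG.contDiffAt_log_sqrt_gramDet hz).differentiableAt (by simp))
        ((hfy z hz).differentiableAt (by simp))
    · exact ((hG.contDiffAt_log_sqrt_gramDet hy).fderiv_right (m := 1)
        (by norm_cast)).differentiableAt (by simp)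
    · exact ((hfy y hy).fderiv_right (m := 1) (by norm_cast)).differentiableAt (by simp)
  have h1 := hric y hy v w
  have h2 := hric y hy (Complex.I • v) (Complex.I • w)
  have h3 := hG.ricci_add_ricci_I hy v w
  rw [hessian] at h1 h2
  -- The terms `df(Γ(v, w))` of the two Hessians become opposite and disappear from the sum.
  rw [hG.christoffel_I_I hy, map_neg] at h2
  rw [hadd]
  simp only [add_apply]
  linarith

end IsKahlerMetricOn

/-! ### Pluriharmonic functions -/

/-- A pluriharmonic function on a convex open set is the real part of a holomorphic function. -/
theorem exists_holomorphic_re_eq_of_pluriharmonic {E : Type*} [NormedAddCommGroup E]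
    [NormedSpace ℂ E] {s : Set E} (hso : IsOpen s) (hs : Convex ℝ s) {u : E → ℝ}
    (hu : ContDiffOn ℝ ∞ u s)
    (hpl : ∀ y ∈ s, ∀ v w, fderiv ℝ (fderiv ℝ u) y v w +
      fderiv ℝ (fderiv ℝ u) y (Complex.I • v) (Complex.I • w) = 0) :
    ∃ h : E → ℂ, DifferentiableOn ℂ h s ∧ ∀ y ∈ s, (h y).re = u y := by
  rcases s.eq_empty_or_nonempty with rfl | ⟨y₀, hy₀⟩
  · exact ⟨0, by simp⟩
  have huy (y) (hy : y ∈ s) : ContDiffAt ℝ ∞ u y := hu.contDiffAt (hso.mem_nhds hy)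
  have hI (v : E) : Complex.I • Complex.I • v = -v := by
    rw [smul_smul, Complex.I_mul_I, neg_one_smul]
  let J : E →L[ℝ] E := (Complex.I • ContinuousLinearMap.id ℂ E : E →L[ℂ] E).restrictScalars ℝ
  -- `T l` is the complex linear form with real part `l`. Thus `θ = T(du) = 2∂u`, and
  -- pluriharmonicity says exactly that `θ` is closed; its primitive on the convex set is the
  -- desired function up to a real constant.
  let T : (E →L[ℝ] ℝ) →L[ℝ] (E →L[ℝ] ℂ) :=
    ContinuousLinearMap.compL ℝ E ℝ ℂ Complex.ofRealCLM -
      (ContinuousLinearMap.compL ℝ E ℝ ℂ (Complex.I • Complex.ofRealCLM)) ∘L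
        (ContinuousLinearMap.compL ℝ E E ℝ).flip J
  have hT (l : E →L[ℝ] ℝ) (w : E) : T l w = (l w : ℂ) - Complex.I * l (Complex.I • w) := rfl
  let θ : E → E →L[ℝ] ℂ := fun y => T (fderiv ℝ u y)
  have hdu (y) (hy : y ∈ s) : DifferentiableAt ℝ (fderiv ℝ u) y :=
    ((huy y hy).fderiv_right (m := 1) (by norm_cast)).differentiableAt (by simp)
  have hθ (y) (hy : y ∈ s) : HasFDerivAt θ (T ∘L fderiv ℝ (fderiv ℝ u) y) y :=
    T.hasFDerivAt.comp y (hdu y hy).hasFDerivAt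
  obtain ⟨h, hh⟩ := hs.exists_forall_hasFDerivAt_of_fderiv_symmetric hso
    (show DifferentiableOn ℝ θ s from fun y hy =>
      (hθ y hy).differentiableAt.differentiableWithinAt) fun y hy v w => by
      have hsymm := (huy y hy).isSymmSndFDerivAt
        (by rw [minSmoothness_of_isRCLikeNormedField]; norm_cast)
      rw [(hθ y hy).fderiv, ContinuousLinearMap.comp_apply, ContinuousLinearMap.comp_apply, hT, hT,
        hsymm.eq v w]
      have h1 := hpl y hy (Complex.I • v) w
      rw [hI, map_neg, neg_apply, hsymm.eq (Complex.I • v) w] at h1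
      rw [show fderiv ℝ (fderiv ℝ u) y v (Complex.I • w) =
        fderiv ℝ (fderiv ℝ u) y w (Complex.I • v) by linarith]
  have hθre (y : E) : Complex.reCLM ∘L θ y = fderiv ℝ u y := by
    ext w
    simp [θ, hT]
  have hre (y) (hy : y ∈ s) : HasFDerivAt (fun z => (h z).re - u z) (0 : E →L[ℝ] ℝ) y := by
    have h1 := (Complex.reCLM.hasFDerivAt.comp y (hh y hy)).sub
      ((huy y hy).differentiableAt (by simp)).hasFDerivAt
    rw [hθre, sub_self] at h1
    exact h1
  have hconst (y) (hy : y ∈ s) : (h y).re - u y = (h y₀).re - u y₀ :=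
    hs.is_const_of_fderivWithin_eq_zero (𝕜 := ℝ) (f := fun z => (h z).re - u z)
      (fun z hz => (hre z hz).differentiableAt.differentiableWithinAt)
      (fun z hz => by
        rw [fderivWithin_of_isOpen hso hz, (hre z hz).fderiv]) hy hy₀
  refine ⟨fun y => h y - (((h y₀).re - u y₀ : ℝ) : ℂ), fun y hy => ?_, fun y hy => ?_⟩
  · refine (DifferentiableAt.sub_const ?_ _).differentiableWithinAt
    -- Holomorphy means that the real derivative `θ y` is complex linear.
    rw [differentiableAt_iff_restrictScalars ℝ (hh y hy).differentiableAt, (hh y hy).fderiv]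
    have hlin (w : E) : θ y (Complex.I • w) = Complex.I • θ y w := by
      simp only [θ, hT, hI, map_neg, smul_eq_mul, mul_sub, ← mul_assoc, Complex.I_mul_I]
      push_cast
      ring
    refine ⟨{ toFun := θ y, map_add' := map_add _, map_smul' := fun c w => ?_, cont := ?_ }, rfl⟩
    · have hc : c • w = c.re • w + c.im • Complex.I • w := by
        conv_lhs => rw [← Complex.re_add_im c, add_smul, mul_smul]
        rfl
      rw [hc, map_add, map_smul, map_smul, hlin, RingHom.id_apply]
      conv_rhs => rw [← Complex.re_add_im c, add_smul, mul_smul]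
      rfl
    · exact (θ y).cont
  · have := hconst y hy
    simp only [Complex.sub_re, Complex.ofReal_re]
    linarith

/-! ### Flat bundles on simply connected spaces -/

open Topology in
/-- A locally constant cocycle on a simply connected space is a coboundary. -/
theorem exists_locally_constant_primitive_of_cocycle {X ι Γ : Type*} [TopologicalSpace X]
    [SimplyConnectedSpace X] [LocallyPathConnectedSpace X] [Group Γ]
    (U : ι → Set X) (hU : ∀ i, IsOpen (U i)) (hcover : ∀ x, ∃ i, x ∈ U i)
    (c : ι → ι → X → Γ)
    (hc : ∀ i j, ∀ x ∈ U i ∩ U j, ∀ᶠ z in 𝓝 x, c i j z = c i j x)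
    (hcc : ∀ i j k, ∀ x ∈ U i ∩ U j ∩ U k, c j k x * c i j x = c i k x) :
    ∃ s : ι → X → Γ, (∀ i, ∀ x ∈ U i, ∀ᶠ z in 𝓝 x, s i z = s i x) ∧
      ∀ i j, ∀ x ∈ U i ∩ U j, s j x = c i j x * s i x := by
  -- With the discrete topology on `Γ`, locally constant means continuous, and the bundle glued by
  -- `c` is a covering space.
  let _ : TopologicalSpace Γ := ⊥
  have : DiscreteTopology Γ := ⟨rfl⟩
  choose idx hidx using hcover
  have hself (i x) (hx : x ∈ U i) : c i i x = 1 := by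
    have := hcc i i i x ⟨⟨hx, hx⟩, hx⟩
    simpa using this
  let Z : FiberBundleCore ι X Γ :=
    { baseSet := U
      isOpen_baseSet := hU
      indexAt := idx
      mem_baseSet_at := hidx
      coordChange := fun i j x g => c i j x * g
      coordChange_self := fun i x hx g => by rw [hself i x hx, one_mul]
      continuousOn_coordChange := fun i j => by
        rintro ⟨x, g⟩ ⟨hx, -⟩
        refine ContinuousAt.continuousWithinAt ?_
        have : (fun p : X × Γ => c i j p.1 * p.2) =ᶠ[𝓝 (x, g)] fun p => c i j x * p.2 := by
          have h := (continuous_fst.tendsto (x, g)).eventually (hc i j x hx)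
          filter_upwards [h] with p hp
          rw [hp]
        refine ContinuousAt.congr ?_ this.symm
        exact ((continuous_of_discreteTopology (f := fun g' : Γ => c i j x * g')).comp
          continuous_snd).continuousAt
      coordChange_comp := fun i j k x hx g => by rw [← mul_assoc, hcc i j k x hx] }
  have hcov : IsCoveringMap Z.proj := FiberBundle.isCoveringMap (F := Γ) (E := Z.Fiber)
  obtain ⟨x₀⟩ := (inferInstance : Nonempty X)
  -- The identity lifts because `X` is simply connected. The lift is a global section, and `s i` is
  -- its coordinate in the `i`-th trivialization.
  obtain ⟨F, ⟨-, hF⟩, -⟩ := hcov.existsUnique_continuousMap_lifts (ContinuousMap.id X) x₀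
    (⟨x₀, (1 : Γ)⟩ : Z.TotalSpace) rfl
  have hFx (x : X) : (F x).proj = x := congrFun hF x
  refine ⟨fun i x => (Z.localTriv i (F x)).2, fun i x hx => ?_, fun i j x hx => ?_⟩
  · have hcont : ContinuousAt (fun z => (Z.localTriv i (F z)).2) x := by
      have h1 : ContinuousAt (Z.localTriv i) (F x) :=
        (Z.localTriv i).continuousAt ((Z.localTriv i).mem_source.mpr (by
          change (F x).proj ∈ U i
          rwa [hFx]))
      exact (continuous_snd.continuousAt.comp h1).comp F.continuous.continuousAt
    exact hcont.eventually (isOpen_discrete {(Z.localTriv i (F x)).2} |>.mem_nhds rfl)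
  · let γ : Γ := (F x).2
    change c (idx (F x).proj) j (F x).proj * γ = c i j x * (c (idx (F x).proj) i (F x).proj * γ)
    rw [← mul_assoc, hFx, hcc _ _ _ x ⟨⟨hidx x, hx.1⟩, hx.2⟩]

/-! ### Charts of a complex manifold -/

section Charts

open Topology

variable {n : ℕ} {M : Type*} [TopologicalSpace M] [ChartedSpace (Cn n) M]

/-- The complex derivative of the inverse of the chart `φ`, at the point `x`, in the preferred
trivialization of the tangent space at `x`. -/
def chartDeriv (φ : OpenPartialHomeomorph M (Cn n)) (x : M) : Cn n →L[ℂ] Cn n :=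
  fderiv ℂ (chartAt (Cn n) x ∘ φ.symm) (φ x)

/-- The complex Jacobian determinant of the inverse of the chart `φ`. -/
def chartJac (φ : OpenPartialHomeomorph M (Cn n)) (x : M) : ℂ :=
  LinearMap.det (chartDeriv φ x).toLinearMap

variable [IsManifold 𝓘(ℂ, Cn n) ω M]

theorem contDiffAt_transition {φ ψ : OpenPartialHomeomorph M (Cn n)} (hφ : φ ∈ atlas (Cn n) M)
    (hψ : ψ ∈ atlas (Cn n) M) {y : Cn n} (hy : y ∈ φ.target) (hy' : φ.symm y ∈ ψ.source) :
    ContDiffAt ℂ ω (ψ ∘ φ.symm) y := by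
  have h := (contDiffGroupoid ω 𝓘(ℂ, Cn n)).compatible hφ hψ
  rw [contDiffGroupoid, mem_groupoid_of_pregroupoid] at h
  have h1 : ContDiffOn ℂ ω (ψ ∘ φ.symm) (φ.symm.trans ψ).source := by
    simpa [contDiffPregroupoid] using h.1
  exact h1.contDiffAt ((φ.symm.trans ψ).open_source.mem_nhds (by simp [hy, hy']))

/-- The tangent space at `x` is the model space through the preferred chart at `x`, so the manifold
derivative is an ordinary one; the chart used on the target side changes with the point. -/
theorem dChartSymmC_eq {φ : OpenPartialHomeomorph M (Cn n)} (hφ : φ ∈ atlas (Cn n) M)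
    {y : Cn n} (hy : y ∈ φ.target) :
    (dChartSymmC φ y : Cn n →L[ℂ] Cn n) = chartDeriv φ (φ.symm y) := by
  have h : MDifferentiableAt 𝓘(ℂ, Cn n) 𝓘(ℂ, Cn n) φ.symm y :=
    mdifferentiableAt_atlas_symm hφ hy
  refine h.mfderiv.trans ?_
  rw [chartDeriv, φ.right_inv hy]
  simp only [writtenInExtChartAt, extChartAt_model_space_eq_id, modelWithCornersSelf_coe,
    Set.range_id, fderivWithin_univ]
  rfl

theorem dChartSymm_eq {φ : OpenPartialHomeomorph M (Cn n)} (hφ : φ ∈ atlas (Cn n) M)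
    {y : Cn n} (hy : y ∈ φ.target) :
    (dChartSymm φ y : Cn n →L[ℝ] Cn n) = (chartDeriv φ (φ.symm y)).restrictScalars ℝ := by
  have h : MDifferentiableAt 𝓘(ℝ, Cn n) 𝓘(ℝ, Cn n) φ.symm y :=
    mdifferentiableAt_atlas_symm hφ hy
  have hd := (contDiffAt_transition hφ (chart_mem_atlas (Cn n) (φ.symm y)) hy
    (mem_chart_source _ _)).differentiableAt (by simp)
  refine h.mfderiv.trans ?_
  rw [chartDeriv, φ.right_inv hy, ← hd.fderiv_restrictScalars ℝ]
  simp only [writtenInExtChartAt, extChartAt_model_space_eq_id, modelWithCornersSelf_coe,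
    Set.range_id, fderivWithin_univ]
  rfl

theorem chartDeriv_eq_comp {φ ψ : OpenPartialHomeomorph M (Cn n)} (hφ : φ ∈ atlas (Cn n) M)
    (hψ : ψ ∈ atlas (Cn n) M) {x : M} (hx : x ∈ φ.source) (hx' : x ∈ ψ.source) :
    chartDeriv φ x = chartDeriv ψ x ∘L fderiv ℂ (ψ ∘ φ.symm) (φ x) := by
  have hd1 : DifferentiableAt ℂ (ψ ∘ φ.symm) (φ x) :=
    (contDiffAt_transition hφ hψ (φ.map_source hx) (by rwa [φ.left_inv hx])).differentiableAt
      (by simp)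
  have hd2 : DifferentiableAt ℂ (chartAt (Cn n) x ∘ ψ.symm) ((ψ ∘ φ.symm) (φ x)) := by
    rw [Function.comp_apply, φ.left_inv hx]
    exact (contDiffAt_transition hψ (chart_mem_atlas (Cn n) x) (ψ.map_source hx')
      (by rw [ψ.left_inv hx']; exact mem_chart_source _ _)).differentiableAt (by simp)
  have h := fderiv_comp (φ x) hd2 hd1
  rw [show (ψ ∘ φ.symm) (φ x) = ψ x from congrArg ψ (φ.left_inv hx)] at h
  rw [chartDeriv, chartDeriv, ← h]
  refine Filter.EventuallyEq.fderiv_eq ?_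
  have hs : ∀ᶠ y in 𝓝 (φ x), φ.symm y ∈ ψ.source :=
    (φ.continuousAt_symm (φ.map_source hx)).eventually
      (ψ.open_source.mem_nhds (by rwa [φ.left_inv hx]))
  filter_upwards [hs] with y hy
  simp [ψ.left_inv hy]

/-- `chartJac` need not be continuous, since the preferred chart may jump; but the quotient of two
of them is the Jacobian of a transition map, which is holomorphic. -/
theorem chartJac_eq_mul {φ ψ : OpenPartialHomeomorph M (Cn n)} (hφ : φ ∈ atlas (Cn n) M)
    (hψ : ψ ∈ atlas (Cn n) M) {x : M} (hx : x ∈ φ.source) (hx' : x ∈ ψ.source) :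
    chartJac φ x = chartJac ψ x *
      LinearMap.det (fderiv ℂ (ψ ∘ φ.symm) (φ x)).toLinearMap := by
  rw [chartJac, chartDeriv_eq_comp hφ hψ hx hx', chartJac, ← LinearMap.det_comp]
  rfl

omit [IsManifold 𝓘(ℂ, Cn n) ω M] in
theorem chartDeriv_chartAt_self (x : M) :
    chartDeriv (chartAt (Cn n) x) x = ContinuousLinearMap.id ℂ (Cn n) := by
  rw [chartDeriv, ← fderiv_id (𝕜 := ℂ) (x := chartAt (Cn n) x x)]
  refine Filter.EventuallyEq.fderiv_eq ?_
  filter_upwards [(chartAt (Cn n) x).open_target.mem_nhds (mem_chart_target _ x)] with y hy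
  exact (chartAt (Cn n) x).right_inv hy

theorem chartJac_ne_zero {φ : OpenPartialHomeomorph M (Cn n)} (hφ : φ ∈ atlas (Cn n) M)
    {x : M} (hx : x ∈ φ.source) : chartJac φ x ≠ 0 := by
  have h := chartJac_eq_mul (chart_mem_atlas (Cn n) x) hφ (mem_chart_source _ x) hx
  rw [chartJac, chartDeriv_chartAt_self] at h
  intro h0
  rw [h0, zero_mul] at h
  exact one_ne_zero (LinearMap.det_id.symm.trans h)

theorem differentiable_det_complex (n : ℕ) :
    Differentiable ℂ fun A : Cn n →L[ℂ] Cn n => LinearMap.det A.toLinearMap := by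
  let b := (EuclideanSpace.basisFun (Fin n) ℂ).toBasis
  have h (A : Cn n →L[ℂ] Cn n) : LinearMap.det A.toLinearMap =
      ∑ σ : Equiv.Perm (Fin n), ((Equiv.Perm.sign σ : ℤ) : ℂ) *
        ∏ i, (EuclideanSpace.proj (σ i) : Cn n →L[ℂ] ℂ) (A (b i)) := by
    rw [← LinearMap.det_toMatrix b, Matrix.det_apply']
    simp [LinearMap.toMatrix_apply, b]
  simp only [h]
  fun_prop

theorem differentiableAt_det_transition {φ ψ : OpenPartialHomeomorph M (Cn n)}
    (hφ : φ ∈ atlas (Cn n) M) (hψ : ψ ∈ atlas (Cn n) M) {y : Cn n} (hy : y ∈ φ.target)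
    (hy' : φ.symm y ∈ ψ.source) :
    DifferentiableAt ℂ (fun z => LinearMap.det (fderiv ℂ (ψ ∘ φ.symm) z).toLinearMap) y := by
  have h := ((contDiffAt_transition hφ hψ hy hy').fderiv_right (m := 1) le_top).differentiableAt
    (by simp)
  exact (differentiable_det_complex n _).comp y h

end Charts

/-! ### Holomorphic volume forms in terms of their coefficients -/

theorem topCoeff_compContinuousLinearMap {n : ℕ} (α : Cn n [⋀^Fin n]→L[ℂ] ℂ)
    (L : Cn n →L[ℂ] Cn n) :
    topCoeff (α.compContinuousLinearMap L) = topCoeff α * LinearMap.det L.toLinearMap := by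
  let e := (EuclideanSpace.basisFun (Fin n) ℂ).toBasis
  have he : (e : Fin n → Cn n) = fun k => EuclideanSpace.single k 1 := by
    funext k; simp [e]
  have h := congrArg (fun β => β (L ∘ e)) (α.toAlternatingMap.eq_smul_basis_det e)
  rw [AlternatingMap.smul_apply] at h
  have h2 := e.det_comp L.toLinearMap e
  rw [e.det_self, mul_one] at h2
  rw [show e.det (L ∘ e) = _ from h2, he] at h
  exact h

/-- The standard complex volume form `dz₁ ∧ ⋯ ∧ dzₙ` on `ℂⁿ`. -/
def stdVolume (n : ℕ) : Cn n [⋀^Fin n]→L[ℂ] ℂ where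
  toAlternatingMap := (EuclideanSpace.basisFun (Fin n) ℂ).toBasis.det
  cont := by
    have h (v : Fin n → Cn n) : (EuclideanSpace.basisFun (Fin n) ℂ).toBasis.det v =
        (Matrix.of fun i j => (EuclideanSpace.proj i : Cn n →L[ℂ] ℂ) (v j)).det := by
      rw [Module.Basis.det_apply]
      rfl
    change Continuous fun v : Fin n → Cn n => (EuclideanSpace.basisFun (Fin n) ℂ).toBasis.det v
    simp only [h]
    refine Continuous.matrix_det ?_
    refine continuous_matrix fun i j => ?_
    simp only [Matrix.of_apply]
    fun_prop

theorem eq_topCoeff_smul {n : ℕ} (α : Cn n [⋀^Fin n]→L[ℂ] ℂ) :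
    α = topCoeff α • stdVolume n := by
  let e := (EuclideanSpace.basisFun (Fin n) ℂ).toBasis
  have he : (e : Fin n → Cn n) = fun k => EuclideanSpace.single k 1 := by
    funext k; simp [e]
  ext v
  have h := congrArg (fun β => β v) (α.toAlternatingMap.eq_smul_basis_det e)
  rw [he] at h
  exact h

theorem topCoeff_stdVolume (n : ℕ) : topCoeff (stdVolume n) = 1 := by
  have he : ((EuclideanSpace.basisFun (Fin n) ℂ).toBasis : Fin n → Cn n) =
      fun k => EuclideanSpace.single k 1 := by
    funext k; simp
  have h := (EuclideanSpace.basisFun (Fin n) ℂ).toBasis.det_self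
  rw [he] at h
  exact h

theorem topCoeff_smul {n : ℕ} (c : ℂ) (α : Cn n [⋀^Fin n]→L[ℂ] ℂ) :
    topCoeff (c • α) = c * topCoeff α := rfl

theorem differentiableOn_iff_topCoeff {n : ℕ} {s : Set (Cn n)}
    {F : Cn n → Cn n [⋀^Fin n]→L[ℂ] ℂ} :
    DifferentiableOn ℂ F s ↔ DifferentiableOn ℂ (fun y => topCoeff (F y)) s := by
  constructor
  · intro h
    let ev : (Cn n [⋀^Fin n]→L[ℂ] ℂ) →L[ℂ] ℂ :=
      LinearMap.mkContinuous
        { toFun := topCoeff, map_add' := fun _ _ => rfl, map_smul' := fun _ _ => rfl }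
        (∏ k : Fin n, ‖(EuclideanSpace.single k 1 : Cn n)‖) fun α => by
          rw [mul_comm]; exact α.le_opNorm _
    exact ev.differentiable.comp_differentiableOn h
  · intro h
    have hF : F = fun y => topCoeff (F y) • stdVolume n := funext fun y => eq_topCoeff_smul _
    rw [hF]
    exact h.smul_const _

/-! ### A Kähler metric read in a chart -/

theorem IsHermitianInner.bilinearComp {n : ℕ} {B : Cn n →L[ℝ] Cn n →L[ℝ] ℝ}
    (hB : IsHermitianInner B) (L : Cn n →L[ℂ] Cn n) (hL : LinearMap.det L.toLinearMap ≠ 0) :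
    IsHermitianInner (B.bilinearComp (L.restrictScalars ℝ) (L.restrictScalars ℝ)) where
  symm v w := hB.symm _ _
  pos v hv := by
    refine hB.pos (L v) fun h => hv ?_
    have hinj : Function.Injective L.toLinearMap := by
      have : IsUnit L.toLinearMap := (LinearMap.isUnit_iff_isUnit_det _).mpr hL.isUnit
      exact ((Module.End.isUnit_iff _).mp this).1
    exact hinj (h.trans (map_zero L).symm)
  inner_I v w := by
    simpa using hB.inner_I (L v) (L w)

/-- The alternating form `(v, w) ↦ (B(i v, w) - B(i w, v)) / 2`. -/
def alternatingOfBilin {n : ℕ} (B : Cn n →L[ℝ] Cn n →L[ℝ] ℝ) : Cn n [⋀^Fin 2]→L[ℝ] ℝ where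
  toFun v := 2⁻¹ * (B (Complex.I • v 0) (v 1) - B (Complex.I • v 1) (v 0))
  map_update_add' v i a b := by
    fin_cases i <;> simp [Function.update] <;> ring
  map_update_smul' v i c a := by
    fin_cases i <;> simp [Function.update, smul_comm Complex.I c] <;> ring
  cont := by
    change Continuous fun v : Fin 2 → Cn n =>
      2⁻¹ * (B (Complex.I • v 0) (v 1) - B (Complex.I • v 1) (v 0))
    fun_prop
  map_eq_zero_of_eq' v i j hv hij := by
    have h01 : v 0 = v 1 := by
      fin_cases i <;> fin_cases j <;> simp_all
    simp [h01]

/-- `alternatingOfBilin` as a continuous linear map. -/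
def alternatingOfBilinCLM (n : ℕ) :
    (Cn n →L[ℝ] Cn n →L[ℝ] ℝ) →L[ℝ] Cn n [⋀^Fin 2]→L[ℝ] ℝ :=
  LinearMap.toContinuousLinearMap
    { toFun := alternatingOfBilin
      map_add' := fun B B' => by
        ext v
        change 2⁻¹ * ((B + B') (Complex.I • v 0) (v 1) - (B + B') (Complex.I • v 1) (v 0)) =
          2⁻¹ * (B (Complex.I • v 0) (v 1) - B (Complex.I • v 1) (v 0)) +
            2⁻¹ * (B' (Complex.I • v 0) (v 1) - B' (Complex.I • v 1) (v 0))
        simp only [add_apply]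
        ring
      map_smul' := fun c B => by
        ext v
        change 2⁻¹ * ((c • B) (Complex.I • v 0) (v 1) - (c • B) (Complex.I • v 1) (v 0)) =
          c * (2⁻¹ * (B (Complex.I • v 0) (v 1) - B (Complex.I • v 1) (v 0)))
        simp only [smul_apply, smul_eq_mul]
        ring }

/-- The antisymmetrized formula is alternating for every `B`, hence a linear map of `B` through
which derivatives pass; on Hermitian `B` it returns the Kähler form. -/
theorem alternatingOfBilin_apply {n : ℕ} {B : Cn n →L[ℝ] Cn n →L[ℝ] ℝ} (hB : IsHermitianInner B)
    (v : Fin 2 → Cn n) : alternatingOfBilin B v = B (Complex.I • v 0) (v 1) := by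
  change 2⁻¹ * (B (Complex.I • v 0) (v 1) - B (Complex.I • v 1) (v 0)) = _
  rw [hB.symm (Complex.I • v 1), hB.inner_I_right]
  ring

section Metric

open Topology

variable {n : ℕ} {M : Type*} [TopologicalSpace M] [ChartedSpace (Cn n) M]
  [IsManifold 𝓘(ℂ, Cn n) ω M]

namespace HermitianMetric

variable (g : HermitianMetric n M)

/-- The metric at `x` as a bilinear form on the model space. -/
def innerAt (x : M) : Cn n →L[ℝ] Cn n →L[ℝ] ℝ := g.inner x

theorem isHermitianInner_innerAt (x : M) : IsHermitianInner (g.innerAt x) where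
  symm := g.symm x
  pos := g.pos x
  inner_I := g.inner_J x

theorem inChart_eq {φ : OpenPartialHomeomorph M (Cn n)} (hφ : φ ∈ atlas (Cn n) M) {y : Cn n}
    (hy : y ∈ φ.target) :
    g.inChart φ y = (g.innerAt (φ.symm y)).bilinearComp
      ((chartDeriv φ (φ.symm y)).restrictScalars ℝ)
      ((chartDeriv φ (φ.symm y)).restrictScalars ℝ) := by
  rw [← dChartSymm_eq hφ hy]
  rfl

theorem isHermitianInner_inChart {φ : OpenPartialHomeomorph M (Cn n)} (hφ : φ ∈ atlas (Cn n) M)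
    {y : Cn n} (hy : y ∈ φ.target) : IsHermitianInner (g.inChart φ y) := by
  rw [g.inChart_eq hφ hy]
  exact (g.isHermitianInner_innerAt _).bilinearComp _ (chartJac_ne_zero hφ (φ.map_target hy))

/-- The real determinant of a complex linear map is `|det|²`, so the volume density transforms like
the squared modulus of the coefficient of an `(n, 0)`-form. -/
theorem sqrt_gramDet_inChart {φ : OpenPartialHomeomorph M (Cn n)} (hφ : φ ∈ atlas (Cn n) M)
    {y : Cn n} (hy : y ∈ φ.target) :
    √(gramDet (g.inChart φ y)) =
      ‖chartJac φ (φ.symm y)‖ ^ 2 * √(gramDet (g.innerAt (φ.symm y))) := by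
  rw [g.inChart_eq hφ hy, gramDet_bilinearComp, det_restrictScalars_complex,
    Real.sqrt_mul (sq_nonneg _), Real.sqrt_sq (sq_nonneg _), chartJac]

theorem contDiffOn_inChart {φ : OpenPartialHomeomorph M (Cn n)} (hφ : φ ∈ atlas (Cn n) M) :
    ContDiffOn ℝ ∞ (g.inChart φ) φ.target := by
  have hmax : φ ∈ IsManifold.maximalAtlas 𝓘(ℝ, Cn n) ω M :=
    IsManifold.subset_maximalAtlas hφ
  have hsymm : ContMDiffOn 𝓘(ℝ, Cn n) 𝓘(ℝ, Cn n) ω φ.symm φ.target :=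
    contMDiffOn_symm_of_mem_maximalAtlas hmax
  have huniq : UniqueMDiffOn 𝓘(ℝ, Cn n) φ.target := φ.open_target.uniqueMDiffOn
  -- Coordinate vector fields are smooth along `φ.symm`, so the smooth bundle metric can be
  -- evaluated on them.
  have hvec (v : Cn n) : ContMDiffOn 𝓘(ℝ, Cn n) (𝓘(ℝ, Cn n).prod 𝓘(ℝ, Cn n)) ∞
      (fun y => (⟨φ.symm y, dChartSymm φ y v⟩ : TangentBundle 𝓘(ℝ, Cn n) M)) φ.target := by
    have h1 := hsymm.contMDiffOn_tangentMapWithin (m := ∞) le_top huniq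
    have h2 : ContMDiffOn 𝓘(ℝ, Cn n) (𝓘(ℝ, Cn n).prod 𝓘(ℝ, Cn n)) ∞
        (fun y => (⟨y, v⟩ : TangentBundle 𝓘(ℝ, Cn n) (Cn n))) φ.target :=
      contMDiffOn_vectorSpace_iff_contDiffOn.mpr contDiffOn_const
    refine (h1.comp h2 fun y hy => hy).congr fun y hy => ?_
    rw [Function.comp_apply, tangentMapWithin, mfderivWithin_of_isOpen φ.open_target hy]
    rfl
  have hval (v w : Cn n) : ContDiffOn ℝ ∞ (fun y => g.inChart φ y v w) φ.target := by
    rw [← contMDiffOn_iff_contDiffOn]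
    intro y hy
    have hg := g.contMDiff.contMDiffAt.comp_contMDiffWithinAt y ((hsymm.of_le le_top) y hy)
    have h : ContMDiffWithinAt 𝓘(ℝ, Cn n) (𝓘(ℝ, Cn n).prod 𝓘(ℝ)) ∞
        (fun z => Bundle.TotalSpace.mk' ℝ (E := Bundle.Trivial M ℝ) (φ.symm z)
          (g.inner (φ.symm z) (dChartSymm φ z v) (dChartSymm φ z w))) φ.target y := by
      apply ContMDiffWithinAt.clm_bundle_apply₂ (F₁ := Cn n) (F₂ := Cn n)
      · exact hg
      · exact hvec v y hy
      · exact hvec w y hy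
    simp only [Bundle.contMDiffWithinAt_totalSpace] at h
    exact h.2
  exact contDiffOn_clm_apply.mpr fun v => contDiffOn_clm_apply.mpr fun w => hval v w

theorem isKahlerMetricOn_inChart (hg : g.IsKahler) {φ : OpenPartialHomeomorph M (Cn n)}
    (hφ : φ ∈ atlas (Cn n) M) : IsKahlerMetricOn (g.inChart φ) φ.target where
  isOpen := φ.open_target
  contDiffOn := g.contDiffOn_inChart hφ
  isHermitianInner _ hy := g.isHermitianInner_inChart hφ hy
  closed y hy u v w := by
    have hform : ∀ z ∈ φ.target,
        g.kahlerFormInChart φ z = alternatingOfBilinCLM n (g.inChart φ z) := fun z hz => by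
      ext a
      refine Eq.trans ?_ (alternatingOfBilin_apply (g.isHermitianInner_inChart hφ hz) a).symm
      rw [g.inChart_eq hφ hz]
      let L : Cn n →L[ℝ] Cn n := dChartSymm φ z
      have hL : L = (chartDeriv φ (φ.symm z)).restrictScalars ℝ := dChartSymm_eq hφ hz
      change g.innerAt (φ.symm z) (Complex.I • L (a 0)) (L (a 1)) = g.innerAt (φ.symm z)
          (chartDeriv φ (φ.symm z) (Complex.I • a 0)) (chartDeriv φ (φ.symm z) (a 1))
      rw [hL]
      exact congrArg (fun t => g.innerAt (φ.symm z) t _)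
        (map_smul (chartDeriv φ (φ.symm z)) Complex.I (a 0)).symm
    have hev : g.kahlerFormInChart φ =ᶠ[𝓝 y] fun z => alternatingOfBilinCLM n (g.inChart φ z) := by
      filter_upwards [φ.open_target.mem_nhds hy] with z hz using hform z hz
    have hd : DifferentiableAt ℝ (g.inChart φ) y :=
      ((g.contDiffOn_inChart hφ).contDiffAt (φ.open_target.mem_nhds hy)).differentiableAt (by simp)
    have hd2 : DifferentiableAt ℝ (fun z => alternatingOfBilinCLM n (g.inChart φ z)) y :=
      (alternatingOfBilinCLM n).differentiableAt.comp y hd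
    have hclosed := hg φ hφ y hy
    rw [hev.extDeriv_eq] at hclosed
    have h := congrArg (fun β => β ![u, v, w]) hclosed
    rw [extDeriv_apply hd2, Fin.sum_univ_three] at h
    have hval (a : Cn n) (b : Fin 2 → Cn n) :
        fderiv ℝ (fun z => alternatingOfBilinCLM n (g.inChart φ z) b) y a =
          fderiv ℝ (g.inChart φ) y a (Complex.I • b 0) (b 1) := by
      have h1 : (fun z => alternatingOfBilinCLM n (g.inChart φ z) b) =ᶠ[𝓝 y]
          fun z => g.inChart φ z (Complex.I • b 0) (b 1) := by
        filter_upwards [φ.open_target.mem_nhds hy] with z hz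
        exact alternatingOfBilin_apply (g.isHermitianInner_inChart hφ hz) b
      have h2 := ((hd.hasFDerivAt.clm_apply (hasFDerivAt_const (Complex.I • b 0) y)).clm_apply
        (hasFDerivAt_const (b 1) y)).fderiv
      rw [h1.fderiv_eq, h2]
      simp
    simp only [hval] at h
    have e1 : (Fin.removeNth 1 ![u, v, w] : Fin 2 → Cn n) 0 = u := rfl
    have e2 : (Fin.removeNth 1 ![u, v, w] : Fin 2 → Cn n) 1 = w := rfl
    have e3 : (Fin.removeNth 2 ![u, v, w] : Fin 2 → Cn n) 0 = u := rfl
    have e4 : (Fin.removeNth 2 ![u, v, w] : Fin 2 → Cn n) 1 = v := rfl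
    have e5 : (Fin.removeNth 0 ![u, v, w] : Fin 2 → Cn n) 0 = v := rfl
    have e6 : (Fin.removeNth 0 ![u, v, w] : Fin 2 → Cn n) 1 = w := rfl
    rw [e1, e2, e3, e4, e5, e6] at h
    simpa [sub_eq_add_neg] using h

end HermitianMetric

end Metric

/-! ### Local existence and uniqueness of associated volume forms -/

theorem eq_smul_of_topCoeff_eq {n : ℕ} {α β : Cn n [⋀^Fin n]→L[ℂ] ℂ} {c : ℂ}
    (h : topCoeff β = c * topCoeff α) : β = c • α :=
  calc
    β = (c * topCoeff α) • stdVolume n := h ▸ eq_topCoeff_smul β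
    _ = c • (topCoeff α • stdVolume n) := mul_smul _ _ _
    _ = c • α := congrArg (c • ·) (eq_topCoeff_smul α).symm

section LocalSolutions

open Topology

variable {n : ℕ} {M : Type*} [TopologicalSpace M] [ChartedSpace (Cn n) M]
  [IsManifold 𝓘(ℂ, Cn n) ω M]

/-- The form `q dz₁ ∧ ⋯ ∧ dzₙ`, where `z` is the preferred chart at each point, is on `U` a
holomorphic volume form associated to `g` and `f`. -/
structure IsAssociatedOn (g : HermitianMetric n M) (f : M → ℝ) (q : M → ℂ) (U : Set M) :
    Prop where
  sqrt_gramDet_eq : ∀ x ∈ U, √(gramDet (g.innerAt x)) = Real.exp (-f x) * ‖q x‖ ^ 2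
  differentiableAt : ∀ φ ∈ atlas (Cn n) M, ∀ y ∈ φ.target, φ.symm y ∈ U →
    DifferentiableAt ℂ (fun z => q (φ.symm z) * chartJac φ (φ.symm z)) y

namespace IsAssociatedOn

variable {g : HermitianMetric n M} {f : M → ℝ} {q q' : M → ℂ} {U V : Set M}

theorem mono (h : IsAssociatedOn g f q U) (hVU : V ⊆ U) : IsAssociatedOn g f q V :=
  ⟨fun x hx => h.1 x (hVU hx), fun φ hφ y hy hyU => h.2 φ hφ y hy (hVU hyU)⟩

theorem ne_zero (h : IsAssociatedOn g f q U) {x : M} (hx : x ∈ U) : q x ≠ 0 := by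
  intro h0
  have h1 := h.sqrt_gramDet_eq x hx
  rw [h0, norm_zero, zero_pow two_ne_zero, mul_zero] at h1
  exact (Real.sqrt_pos.mpr (g.isHermitianInner_innerAt x).gramDet_pos).ne' h1

theorem norm_eq (h : IsAssociatedOn g f q U) (h' : IsAssociatedOn g f q' U) {x : M}
    (hx : x ∈ U) : ‖q' x‖ = ‖q x‖ := by
  have h1 := (h.sqrt_gramDet_eq x hx).symm.trans (h'.sqrt_gramDet_eq x hx)
  have h2 := mul_left_cancel₀ (Real.exp_pos _).ne' h1
  exact ((pow_left_inj₀ (norm_nonneg _) (norm_nonneg _) two_ne_zero).mp h2).symm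

theorem norm_div (h : IsAssociatedOn g f q U) (h' : IsAssociatedOn g f q' U) {x : M}
    (hx : x ∈ U) : ‖q' x / q x‖ = 1 := by
  rw [_root_.norm_div, h.norm_eq h' hx, div_self (norm_ne_zero_iff.mpr (h.ne_zero hx))]

/-- In a chart the Jacobian factors cancel from the ratio, which is then holomorphic of constant
modulus `1`; the maximum principle on a ball makes it constant. -/
theorem eventually_div_eq (h : IsAssociatedOn g f q U) (h' : IsAssociatedOn g f q' U)
    (hU : IsOpen U) {x : M} (hx : x ∈ U) : ∀ᶠ z in 𝓝 x, q' z / q z = q' x / q x := by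
  let φ := chartAt (Cn n) x
  have hφ : φ ∈ atlas (Cn n) M := chart_mem_atlas _ x
  have hxs : x ∈ φ.source := mem_chart_source _ x
  have hopen : IsOpen (φ.target ∩ φ.symm ⁻¹' U) := φ.isOpen_inter_preimage_symm hU
  obtain ⟨r, hr, hball⟩ := Metric.isOpen_iff.mp hopen (φ x)
    ⟨φ.map_source hxs, by simpa [φ.left_inv hxs] using hx⟩
  let R : Cn n → ℂ := fun y => q' (φ.symm y) / q (φ.symm y)
  have hR : DifferentiableOn ℂ R (Metric.ball (φ x) r) := by
    intro y hy
    obtain ⟨hy1, hy2⟩ := hball hy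
    have hJ (z) (hz : z ∈ φ.target) := chartJac_ne_zero hφ (φ.map_target hz)
    have hd1 := h'.differentiableAt φ hφ y hy1 hy2
    have hd2 := h.differentiableAt φ hφ y hy1 hy2
    have hd := hd1.mul (hd2.inv (mul_ne_zero (h.ne_zero hy2) (hJ y hy1)))
    refine (hd.congr_of_eventuallyEq ?_).differentiableWithinAt
    filter_upwards [φ.open_target.mem_nhds hy1] with z hz
    exact (mul_div_mul_right _ _ (hJ z hz)).symm
  have hnorm (y) (hy : y ∈ Metric.ball (φ x) r) : ‖R y‖ = 1 := h.norm_div h' (hball hy).2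
  have hconst := Complex.eqOn_of_isPreconnected_of_isMaxOn_norm
    (convex_ball (φ x) r).isPreconnected Metric.isOpen_ball hR (Metric.mem_ball_self hr)
    (fun y hy => by
      change ‖R y‖ ≤ ‖R (φ x)‖
      rw [hnorm y hy, hnorm _ (Metric.mem_ball_self hr)])
  filter_upwards [(φ.continuousAt hxs).eventually (Metric.ball_mem_nhds (φ x) hr),
    φ.open_source.mem_nhds hxs] with z hz hzs
  have := hconst hz
  simpa [R, φ.left_inv hzs, φ.left_inv hxs] using this

/-- Both defining conditions are local and unaffected by a unit constant. This serves for gluing and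
for the converse half of uniqueness. -/
theorem of_eventually_eq_mul (h : ∀ x ∈ V, ∃ q U, IsOpen U ∧ x ∈ U ∧ IsAssociatedOn g f q U ∧
    ∃ c : ℂ, ‖c‖ = 1 ∧ ∀ᶠ z in 𝓝 x, q' z = c * q z) : IsAssociatedOn g f q' V where
  sqrt_gramDet_eq x hx := by
    obtain ⟨q, U, -, hxU, hq, c, hc, heq⟩ := h x hx
    rw [heq.self_of_nhds, norm_mul, hc, one_mul]
    exact hq.sqrt_gramDet_eq x hxU
  differentiableAt φ hφ y hy hyV := by
    obtain ⟨q, U, -, hxU, hq, c, hc, heq⟩ := h _ hyV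
    refine ((hq.differentiableAt φ hφ y hy hxU).const_mul c).congr_of_eventuallyEq ?_
    filter_upwards [(φ.continuousAt_symm hy).eventually heq] with z hz
    rw [hz, mul_assoc]

end IsAssociatedOn

theorem exists_isAssociatedOn {g : HermitianMetric n M} {f : M → ℝ}
    (hgf : g.IsGradientRicciSoliton f) (x : M) :
    ∃ (q : M → ℂ) (U : Set M), IsOpen U ∧ x ∈ U ∧ IsAssociatedOn g f q U := by
  let φ := chartAt (Cn n) x
  have hφ : φ ∈ atlas (Cn n) M := chart_mem_atlas _ x
  have hxs : x ∈ φ.source := mem_chart_source _ x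
  have hG := g.isKahlerMetricOn_inChart hgf.isKahler hφ
  have hf : ContDiffOn ℝ ∞ (f ∘ φ.symm) φ.target := by
    rw [← contMDiffOn_iff_contDiffOn]
    have hmax : φ ∈ IsManifold.maximalAtlas 𝓘(ℝ, Cn n) ω M := IsManifold.subset_maximalAtlas hφ
    exact hgf.contMDiff_potential.comp_contMDiffOn
      ((contMDiffOn_symm_of_mem_maximalAtlas hmax).of_le le_top)
  obtain ⟨r, hr, hball⟩ := Metric.isOpen_iff.mp φ.open_target (φ x) (φ.map_source hxs)
  let u : Cn n → ℝ := fun z => Real.log √(gramDet (g.inChart φ z)) + (f ∘ φ.symm) z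
  have hu : ContDiffOn ℝ ∞ u (Metric.ball (φ x) r) := fun y hy =>
    ((hG.contDiffAt_log_sqrt_gramDet (hball hy)).add
      (hf.contDiffAt (φ.open_target.mem_nhds (hball hy)))).contDiffWithinAt
  obtain ⟨h, hh, hre⟩ := exists_holomorphic_re_eq_of_pluriharmonic Metric.isOpen_ball
    (convex_ball (φ x) r) hu fun y hy v w =>
      hG.pluriharmonic_of_ricci_eq_hessian hf (hgf.ricci_eq_hessian φ hφ) (hball hy) v w
  let U : Set M := φ.source ∩ φ ⁻¹' Metric.ball (φ x) r
  -- The half is there because the volume form involves the squared modulus: `|a|² = e^{Re h} =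
  -- √(det G) e^f`.
  let a : Cn n → ℂ := fun y => Complex.exp (2⁻¹ * h y)
  have ha : DifferentiableOn ℂ a (Metric.ball (φ x) r) := (hh.const_mul (2⁻¹ : ℂ)).cexp
  have hnorm (y) (hy : y ∈ Metric.ball (φ x) r) : ‖a y‖ ^ 2 = Real.exp (u y) := by
    rw [Complex.norm_exp, ← Real.exp_nat_mul, ← hre y hy]
    congr 1
    simp
  -- `a` is the coefficient in the fixed chart `φ`; dividing by the Jacobian gives the coefficient
  -- in the preferred chart at each point.
  refine ⟨fun z => a (φ z) / chartJac φ z, U, φ.isOpen_inter_preimage Metric.isOpen_ball,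
    ⟨hxs, Metric.mem_ball_self hr⟩, ⟨fun z hz => ?_, fun ψ hψ y hy hyU => ?_⟩⟩
  · have hJ := chartJac_ne_zero hφ hz.1
    have hpos : 0 < √(gramDet (g.inChart φ (φ z))) :=
      Real.sqrt_pos.mpr (hG.isHermitianInner _ (φ.map_source hz.1)).gramDet_pos
    have h1 := g.sqrt_gramDet_inChart hφ (φ.map_source hz.1)
    rw [φ.left_inv hz.1] at h1
    have h2 := hnorm _ hz.2
    simp only [u, Function.comp_apply, φ.left_inv hz.1] at h2
    rw [Real.exp_add, Real.exp_log hpos, h1] at h2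
    rw [norm_div, div_pow, h2, Real.exp_neg]
    have hJ' : ‖chartJac φ z‖ ≠ 0 := norm_ne_zero_iff.mpr hJ
    have := (Real.exp_pos (f z)).ne'
    field_simp
  · have hd : DifferentiableAt ℂ (φ ∘ ψ.symm) y :=
      (contDiffAt_transition hψ hφ hy hyU.1).differentiableAt (by simp)
    have ha' : DifferentiableAt ℂ a ((φ ∘ ψ.symm) y) :=
      (ha _ hyU.2).differentiableAt (Metric.isOpen_ball.mem_nhds hyU.2)
    have hd2 := (ha'.comp y hd).mul (differentiableAt_det_transition hψ hφ hy hyU.1)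
    refine hd2.congr_of_eventuallyEq ?_
    filter_upwards [ψ.open_target.mem_nhds hy, (ψ.continuousAt_symm hy).eventually
      (φ.open_source.mem_nhds hyU.1)] with z hz hz'
    have hmul := chartJac_eq_mul hψ hφ (ψ.map_target hz) hz'
    rw [ψ.right_inv hz] at hmul
    have hJ := chartJac_ne_zero hφ hz'
    rw [hmul]
    change _ = a (φ (ψ.symm z)) * _
    field_simp

/-- On a simply connected manifold, local associated volume forms can be patched together. -/
theorem exists_isAssociatedOn_univ [SimplyConnectedSpace M] {g : HermitianMetric n M} {f : M → ℝ}
    (hgf : g.IsGradientRicciSoliton f) : ∃ q : M → ℂ, IsAssociatedOn g f q Set.univ := by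
  have : LocallyPathConnectedSpace M := ChartedSpace.locallyPathConnectedSpace (Cn n) M
  choose q U hU hxU hq using exists_isAssociatedOn hgf
  have hnorm (i j x) (hx : x ∈ U i ∩ U j) : ‖q i x / q j x‖ = 1 :=
    ((hq j).mono Set.inter_subset_right).norm_div ((hq i).mono Set.inter_subset_left) hx
  -- The cocycle must be defined everywhere; off the overlaps the value `1` is arbitrary.
  have hex (i j x) : ∃ c : Circle, x ∈ U i ∩ U j → (c : ℂ) = q i x / q j x := by
    by_cases hx : x ∈ U i ∩ U j
    · exact ⟨⟨q i x / q j x, mem_sphere_zero_iff_norm.mpr (hnorm i j x hx)⟩, fun _ => rfl⟩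
    · exact ⟨1, fun h => (hx h).elim⟩
  choose c hcoe using hex
  obtain ⟨s, hs, hsc⟩ := exists_locally_constant_primitive_of_cocycle U hU
    (fun x => ⟨x, hxU x⟩) c
    (fun i j x hx => by
      have hopen := (hU i).inter (hU j)
      filter_upwards [((hq j).mono Set.inter_subset_right).eventually_div_eq
        ((hq i).mono Set.inter_subset_left) hopen hx, hopen.mem_nhds hx] with z hz hzU
      ext
      rw [hcoe i j z hzU, hcoe i j x hx, hz])
    (fun i j k x hx => by
      ext
      have := (hq j).ne_zero hx.1.2
      rw [Circle.coe_mul, hcoe j k x ⟨hx.1.2, hx.2⟩, hcoe i j x hx.1, hcoe i k x ⟨hx.1.1, hx.2⟩]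
      field_simp)
  -- From `s j = (q i / q j) s i` the products `s i * q i` agree on overlaps, so the index at each
  -- point may be the point itself.
  refine ⟨fun x => s x x * q x x, IsAssociatedOn.of_eventually_eq_mul fun x _ =>
    ⟨q x, U x, hU x, hxU x, hq x, s x x, Circle.norm_coe _, ?_⟩⟩
  filter_upwards [hs x x (hxU x), (hU x).mem_nhds (hxU x)] with z hz hzU
  have hne := (hq z).ne_zero (hxU z)
  rw [hsc x z z ⟨hzU, hxU z⟩, Circle.coe_mul, hcoe x z z ⟨hzU, hxU z⟩, hz]
  field_simp

theorem isAssociatedVolumeForm_iff {g : HermitianMetric n M} {f : M → ℝ}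
    {Υ : CanonicalSection n M} : IsAssociatedVolumeForm g f Υ ↔
      IsAssociatedOn g f (fun x => topCoeff (Υ x : Cn n [⋀^Fin n]→L[ℂ] ℂ)) Set.univ := by
  have hvol (x : M) : (complexify (g.volumeForm x) =
      ((Complex.I ^ n / 2) ^ n * (Real.exp (-f x) : ℂ)) • Υ.wedgeConj x) ↔
      √(gramDet (g.innerAt x)) =
        Real.exp (-f x) * ‖topCoeff (Υ x : Cn n [⋀^Fin n]→L[ℂ] ℂ)‖ ^ 2 :=
    complexify_smul_det_eq_iff _ _ _
  have hcoeff (φ) (hφ : φ ∈ atlas (Cn n) M) (y) (hy : y ∈ φ.target) :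
      topCoeff ((Υ (φ.symm y)).compContinuousLinearMap (dChartSymmC φ y) :
        Cn n [⋀^Fin n]→L[ℂ] ℂ) =
      topCoeff (Υ (φ.symm y) : Cn n [⋀^Fin n]→L[ℂ] ℂ) * chartJac φ (φ.symm y) := by
    refine (topCoeff_compContinuousLinearMap (Υ (φ.symm y)) (dChartSymmC φ y)).trans ?_
    rw [dChartSymmC_eq hφ hy]
    rfl
  have hhol (φ) (hφ : φ ∈ atlas (Cn n) M) : DifferentiableOn ℂ
      (fun y : Cn n => ((Υ (φ.symm y)).compContinuousLinearMap (dChartSymmC φ y) :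
        Cn n [⋀^Fin n]→L[ℂ] ℂ)) φ.target ↔ DifferentiableOn ℂ (fun y =>
          topCoeff (Υ (φ.symm y) : Cn n [⋀^Fin n]→L[ℂ] ℂ) * chartJac φ (φ.symm y)) φ.target := by
    rw [differentiableOn_iff_topCoeff]
    exact differentiableOn_congr (hcoeff φ hφ)
  constructor
  · rintro ⟨⟨-, hd⟩, hv⟩
    exact ⟨fun x _ => (hvol x).mp (hv x), fun φ hφ y hy _ =>
      ((hhol φ hφ).mp (hd φ hφ)).differentiableAt (φ.open_target.mem_nhds hy)⟩
  · intro h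
    refine ⟨⟨fun x hx => ?_, fun φ hφ => ?_⟩, fun x => ?_⟩
    · refine h.ne_zero (Set.mem_univ x) ?_
      rw [hx]
      rfl
    · exact (hhol φ hφ).mpr fun y hy =>
        (h.differentiableAt φ hφ y hy (Set.mem_univ _)).differentiableWithinAt
    · exact (hvol x).mpr (h.sqrt_gramDet_eq x (Set.mem_univ x))

end LocalSolutions

end

/-! ### Existence and uniqueness of the global holomorphic volume form -/

theorem mainTheorem4 {n : ℕ} {M : Type*} [TopologicalSpace M] [T2Space M]
    [ChartedSpace (Cn n) M] [IsManifold 𝓘(ℂ, Cn n) ω M] [SimplyConnectedSpace M]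
    (g : HermitianMetric n M) (f : M → ℝ) (hgf : g.IsGradientRicciSoliton f) :
    (∀ x : M, g.volumeForm x =
      (n.factorial : ℝ)⁻¹ • wedgePow (g.kahlerForm x).toAlternatingMap n) ∧
    (∃ Υ : CanonicalSection n M, IsAssociatedVolumeForm g f Υ) ∧
    (∀ Υ Υ' : CanonicalSection n M, IsAssociatedVolumeForm g f Υ →
      (IsAssociatedVolumeForm g f Υ' ↔ ∃ c : ℂ, ‖c‖ = 1 ∧ ∀ x : M, Υ' x = c • Υ x)) := by
  refine ⟨fun x => ?_, ?_, fun Υ Υ' hΥ => ?_⟩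
  · exact (g.isHermitianInner_innerAt x).sqrt_gramDet_smul_det _ fun v => rfl
  · obtain ⟨q, hq⟩ := exists_isAssociatedOn_univ hgf
    let Υ : CanonicalSection n M := fun x => (q x • stdVolume n : Cn n [⋀^Fin n]→L[ℂ] ℂ)
    refine ⟨Υ, isAssociatedVolumeForm_iff.mpr ?_⟩
    have h (x : M) : topCoeff (Υ x : Cn n [⋀^Fin n]→L[ℂ] ℂ) = q x := by
      change topCoeff (q x • stdVolume n) = q x
      rw [topCoeff_smul, topCoeff_stdVolume, mul_one]
    simpa only [h] using hq
  · let coeff (Υ : CanonicalSection n M) (x : M) : ℂ := topCoeff (Υ x : Cn n [⋀^Fin n]→L[ℂ] ℂ)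
    have hq : IsAssociatedOn g f (coeff Υ) Set.univ := isAssociatedVolumeForm_iff.mp hΥ
    constructor
    · intro hΥ'
      have hq' : IsAssociatedOn g f (coeff Υ') Set.univ := isAssociatedVolumeForm_iff.mp hΥ'
      obtain ⟨x₀⟩ := (inferInstance : Nonempty M)
      -- A locally constant ratio on the connected space `M` is constant, and its modulus is `1` at
      -- `x₀`.
      have hlc : IsLocallyConstant fun x => coeff Υ' x / coeff Υ x :=
        (IsLocallyConstant.iff_eventually_eq _).mpr fun x =>
          hq.eventually_div_eq hq' isOpen_univ (Set.mem_univ x)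
      refine ⟨coeff Υ' x₀ / coeff Υ x₀, hq.norm_div hq' (Set.mem_univ x₀), fun x => ?_⟩
      have hx : coeff Υ' x = coeff Υ' x₀ / coeff Υ x₀ * coeff Υ x := by
        rw [hlc.apply_eq_of_preconnectedSpace x₀ x, div_mul_cancel₀ _ (hq.ne_zero (Set.mem_univ x))]
      exact eq_smul_of_topCoeff_eq hx
    · rintro ⟨c, hc, h⟩
      refine isAssociatedVolumeForm_iff.mpr (IsAssociatedOn.of_eventually_eq_mul fun x _ =>
        ⟨coeff Υ, Set.univ, isOpen_univ, Set.mem_univ x, hq, c, hc, .of_forall fun z => ?_⟩)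
      rw [h z]
      rfl
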